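/- Conventions. All Hilbert spaces are complex and finite-dimensional; $\mathbb{S}(\mathscr{H})$ is the unit sphere of $\mathscr{H}$; a density operator is a positive operator of trace $1$. For $\psi\in\mathscr{H}_1\otimes\mathscr{H}_2$ and $b\in\mathscr{H}_2$ let $\langle b|\psi\rangle\in\mathscr{H}_1$ be the partial inner product, $\langle b|x\otimes y\rangle=\langle b,y\rangle x$. For $\|\psi\|=1$ and an orthonormal basis $b=(b_1,\dots,b_{d_2})$ of $\mathscr{H}_2$ let $$\mu_1^{\psi,b}=\sum_j \|\langle b_j|\psi\rangle\|^2\,\delta_{\langle b_j|\psi\rangle/\|\langle b_j|\psi\rangle\|},\qquad \rho_1^\psi=\mathrm{tr}_2|\psi\rangle\langle\psi| .$$ For a density operator $\rho$ on $\mathscr{H}$ let $G(\rho)$ be the law of $\sum_i Z_i\chi_i$, where $(\chi_i)$ is an orthonormal eigenbasis of $\rho$ with eigenvalues $p_i$ and the $Z_i$ are independent centred complex Gaussians with $\mathbb{E}|Z_i|^2=p_i$ (real and imaginary parts independent with equal variances); let $GA(\rho)(d\psi)=\|\psi\|^2\,G(\rho)(d\psi)$, and let $GAP(\rho)$ be the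 image of $GA(\rho)$ under $\psi\mapsto\psi/\|\psi\|$, a probability measure on $\mathbb{S}(\mathscr{H})$. Write $\mu(f)=\int f\,d\mu$ and $\|f\|_\infty=\sup|f|$. Let $u_{ONB}$ be the uniform distribution on the (ordered) orthonormal bases of $\mathscr{H}_2$ given by the Haar probability measure on $U(\mathscr{H}_2)$. For a density operator $\rho_1$ on $\mathscr{H}_1$ with $\dim\mathscr{H}_1\le\dim\mathscr{H}_2$ let $\mathscr{R}(\rho_1)=\{\psi\in\mathbb{S}(\mathscr{H}_1\otimes\mathscr{H}_2):\rho_1^\psi=\rho_1\}$, and let $u_{\rho_1}$ be the law of $\sum_i\sqrt{p_i}\,\chi_i\otimes\phi_i$, where $(\chi_i)$ is an orthonormal eigenbasis of $\rho_1$ with eigenvalues $p_i$ and $(\phi_i)$ are the first $\dim\mathscr{H}_1$ vectors of a $u_{ONB}$-distributed basis. Theorem. Let $0<\varepsilon<1$, $0<\delta<1$ and $d_1\in\mathbb{N}$. For a number $D_2>0$ consider the following two properties. (A) For every $d_2\in\mathbb{N}$ with $d_2>D_2$ and $d_2>d_1$, all $\mathscr{H}_1,\mathscr{H}_2$ with $\dim\mathscr{H}_1=d_1$,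 $\dim\mathscr{H}_2=d_2$, every orthonormal basis $b$ of $\mathscr{H}_2$, every density operator $\rho_1$ on $\mathscr{H}_1$ and every bounded measurable $f:\mathbb{S}(\mathscr{H}_1)\to\mathbb{R}$, $f\not\equiv 0$, $$u_{\rho_1}\bigl\{\psi\in\mathscr{R}(\rho_1): |\mu_1^{\psi,b}(f)-GAP(\rho_1)(f)|<\varepsilon\|f\|_\infty\bigr\}\ge 1-\delta .$$ (B) For every $d_2\in\mathbb{N}$ with $d_2>D_2$ and $d_2>d_1$, all $\mathscr{H}_1,\mathscr{H}_2$ with $\dim\mathscr{H}_1=d_1$, $\dim\mathscr{H}_2=d_2$, every $\psi\in\mathbb{S}(\mathscr{H}_1\otimes\mathscr{H}_2)$ and every bounded measurable $f:\mathbb{S}(\mathscr{H}_1)\to\mathbb{R}$, $f\not\equiv 0$, $$u_{ONB}\bigl\{b: |\mu_1^{\psi,b}(f)-GAP(\rho_1^\psi)(f)|<\varepsilon\|f\|_\infty\bigr\}\ge 1-\delta .$$ Then there is a number $D_2=D_2(\varepsilon,\delta,d_1)>0$ for which both (A) and (B) hold; moreover, every $D_2>0$ that satisfies (A) also satisfies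 (B). -/

import Mathlib

open MeasureTheory ProbabilityTheory Module
open scoped TensorProduct ENNReal

universe u v

noncomputable section

/-! ### Projection to the unit sphere, Gaussian measures and GAP measures -/

section GAP

variable {H : Type*} [NormedAddCommGroup H] [InnerProductSpace ℂ H]

/-- The projection `P : H \ {0} → 𝕊(H)`, `P ψ = ψ / ‖ψ‖`. -/
def sphereProj (x : ({0}ᶜ : Set H)) : Metric.sphere (0 : H) 1 :=
  ⟨((‖(x : H)‖⁻¹ : ℝ) : ℂ) • (x : H), by
    have h : ‖(x : H)‖ ≠ 0 := norm_ne_zero_iff.mpr x.2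
    simp [norm_smul, h]⟩

/-- The centred complex Gaussian distribution with `𝔼|Z|² = p`: real and imaginary part are
independent centred real Gaussians of equal variance `p / 2`. -/
def complexGaussian (p : ℝ) : Measure ℂ :=
  ((gaussianReal 0 (p / 2).toNNReal).prod (gaussianReal 0 (p / 2).toNNReal)).map
    (fun z => (z.1 : ℂ) + (z.2 : ℂ) * Complex.I)

/-- A density operator: a positive operator of trace one. -/
structure IsDensityOperator (ρ : H →ₗ[ℂ] H) : Prop where
  isPositive : ρ.IsPositive
  trace_eq_one : LinearMap.trace ℂ H ρ = 1

variable [FiniteDimensional ℂ H] [MeasurableSpace H] [BorelSpace H]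

/-- `G(ρ)`: the centred Gaussian measure with covariance `ρ`, i.e. the law of `∑ i, Z i • χ i`
where `χ` is an orthonormal eigenbasis of `ρ` with eigenvalues `p i` and the `Z i` are independent
complex Gaussians with `𝔼|Z i|² = p i`. -/
def gaussianMeasure (ρ : H →ₗ[ℂ] H) (hρ : ρ.IsSymmetric) : Measure H :=
  (Measure.pi fun i : Fin (finrank ℂ H) => complexGaussian (hρ.eigenvalues rfl i)).map
    (fun z => ∑ i, z i • hρ.eigenvectorBasis rfl i)

/-- `GA(ρ)(dψ) = ‖ψ‖² G(ρ)(dψ)`. -/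
def gaMeasure (ρ : H →ₗ[ℂ] H) (hρ : ρ.IsSymmetric) : Measure H :=
  (gaussianMeasure ρ hρ).withDensity (fun ψ => ‖ψ‖ₑ ^ 2)

/-- `GAP(ρ)`: the image of `GA(ρ)` (which gives no mass to `0`) under `P`, a measure on the
unit sphere. -/
def gapMeasure (ρ : H →ₗ[ℂ] H) (hρ : ρ.IsSymmetric) : Measure (Metric.sphere (0 : H) 1) :=
  ((gaMeasure ρ hρ).comap (Subtype.val : ({0}ᶜ : Set H) → H)).map sphereProj

/-- `‖f‖_∞ = sup |f|` for a bounded function `f` on the unit sphere. -/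
def supNorm (f : Metric.sphere (0 : H) 1 → ℝ) : ℝ := ⨆ x, |f x|

end GAP

/-! ### Reduced density matrix and distribution of the conditional wave function -/

section Composite

variable {H₁ : Type*} [NormedAddCommGroup H₁] [InnerProductSpace ℂ H₁]
variable {H₂ : Type*} [NormedAddCommGroup H₂] [InnerProductSpace ℂ H₂]

/-- The partial inner product `⟨b|ψ⟩ ∈ H₁` of `ψ ∈ H₁ ⊗ H₂` with `b ∈ H₂`, determined by
`⟨b|x ⊗ y⟩ = ⟨b, y⟩ x`. -/
def partialInner (b : H₂) (ψ : H₁ ⊗[ℂ] H₂) : H₁ :=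
  TensorProduct.rid ℂ H₁ (LinearMap.lTensor H₁ (innerₛₗ ℂ b) ψ)

/-- The reduced density matrix `ρ₁^ψ = tr₂ |ψ⟩⟨ψ| = ∑ j, ⟨b_j|ψ⟩⟨ψ|b_j⟩`, evaluated in an
orthonormal basis of `H₂`. -/
def reducedDensity [FiniteDimensional ℂ H₂] (ψ : H₁ ⊗[ℂ] H₂) : H₁ →ₗ[ℂ] H₁ :=
  ∑ j, (InnerProductSpace.rankOne ℂ (partialInner (stdOrthonormalBasis ℂ H₂ j) ψ)
    (partialInner (stdOrthonormalBasis ℂ H₂ j) ψ)).toLinearMap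

theorem reducedDensity_isSymmetric [FiniteDimensional ℂ H₂] (ψ : H₁ ⊗[ℂ] H₂) :
    (reducedDensity ψ).IsSymmetric := by
  intro x y
  simp only [reducedDensity, LinearMap.sum_apply, sum_inner, inner_sum]
  exact Finset.sum_congr rfl fun j _ => InnerProductSpace.isSymmetric_rankOne_self _ x y

variable [MeasurableSpace H₁]

open Classical in
/-- The distribution `μ₁^{ψ,b} = ∑ j, ‖⟨b_j|ψ⟩‖² δ_{⟨b_j|ψ⟩ / ‖⟨b_j|ψ⟩‖}` of the conditional wave
function, a measure on the unit sphere of `H₁`; indices with `⟨b_j|ψ⟩ = 0` carry no weight. -/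
def condMeasure {ι : Type*} [Fintype ι] (ψ : H₁ ⊗[ℂ] H₂) (b : OrthonormalBasis ι ℂ H₂) :
    Measure (Metric.sphere (0 : H₁) 1) :=
  ∑ j, if h : partialInner (b j) ψ ≠ 0 then
    ‖partialInner (b j) ψ‖ₑ ^ 2 • Measure.dirac (sphereProj ⟨partialInner (b j) ψ, h⟩) else 0

end Composite

/-! ### The uniform distributions on orthonormal bases and on `𝓡(ρ₁)` -/

section Uniform

variable (H : Type*) [NormedAddCommGroup H] [InnerProductSpace ℂ H] [FiniteDimensional ℂ H]
  [CompleteSpace H]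

instance compactSpace_unitaryGroup : CompactSpace (unitary (H →L[ℂ] H)) := by
  have : ProperSpace (H →L[ℂ] H) := FiniteDimensional.proper ℂ _
  refine (isCompact_iff_compactSpace (s := (unitary (H →L[ℂ] H) : Set (H →L[ℂ] H)))).mp ?_
  refine (isCompact_closedBall (0 : H →L[ℂ] H) 1).of_isClosed_subset isClosed_unitary ?_
  intro U hU
  rw [mem_closedBall_zero_iff]
  refine ContinuousLinearMap.opNorm_le_bound _ zero_le_one fun x => ?_
  have h := (Unitary.linearIsometryEquiv (⟨U, hU⟩ : unitary (H →L[ℂ] H))).norm_map x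
  rw [one_mul]
  exact h.le

/-- The normalized Haar measure on the unitary group `U(H)`. -/
def haarUnitary : Measure (unitary (H →L[ℂ] H)) :=
  Measure.haarMeasure ⊤

/-- The σ-algebra on orthonormal bases `(b_1, …, b_d)` inherited from `H^d`. -/
instance measurableSpaceOrthonormalBasis {ι : Type*} [Fintype ι] [MeasurableSpace H] :
    MeasurableSpace (OrthonormalBasis ι ℂ H) :=
  MeasurableSpace.comap (fun b i => b i) MeasurableSpace.pi

/-- The uniform distribution `u_ONB` on (ordered) orthonormal bases: the law of
`(U b_1, …, U b_d)` for Haar distributed `U` and a fixed orthonormal basis `b`. -/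
def uniformONB [MeasurableSpace H] :
    Measure (OrthonormalBasis (Fin (finrank ℂ H)) ℂ H) :=
  (haarUnitary H).map fun U => (stdOrthonormalBasis ℂ H).map (Unitary.linearIsometryEquiv U)

variable {H₁ : Type*} [NormedAddCommGroup H₁] [InnerProductSpace ℂ H₁] [FiniteDimensional ℂ H₁]
variable {H₂ : Type*} [NormedAddCommGroup H₂] [InnerProductSpace ℂ H₂] [FiniteDimensional ℂ H₂]

/-- `H₁ ⊗ H₂` carries its Borel σ-algebra. -/
instance measurableSpaceTensor : MeasurableSpace (H₁ ⊗[ℂ] H₂) := borel _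

/-- `𝓡(ρ₁)`: the normalized `ψ ∈ H₁ ⊗ H₂` with reduced density matrix `ρ₁`. -/
def stateSet (ρ₁ : H₁ →ₗ[ℂ] H₁) : Set (H₁ ⊗[ℂ] H₂) :=
  {ψ | ‖ψ‖ = 1 ∧ reducedDensity ψ = ρ₁}

/-- The uniform distribution `u_{ρ₁}` on `𝓡(ρ₁)`: the law of `∑ i, √(p i) • χ i ⊗ φ i`, where
`χ` is an orthonormal eigenbasis of `ρ₁` with eigenvalues `p i` and `φ` consists of the first
`dim H₁` vectors of a uniformly distributed orthonormal basis of `H₂`. -/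
def uniformState [CompleteSpace H₂] [MeasurableSpace H₂] (ρ₁ : H₁ →ₗ[ℂ] H₁)
    (hρ : ρ₁.IsSymmetric) (hd : finrank ℂ H₁ ≤ finrank ℂ H₂) : Measure (H₁ ⊗[ℂ] H₂) :=
  (uniformONB H₂).map fun b =>
    ∑ i, ((Real.sqrt (hρ.eigenvalues rfl i) : ℝ) : ℂ) •
      (hρ.eigenvectorBasis rfl i ⊗ₜ[ℂ] b (Fin.castLE hd i))

end Uniform

/-! ### The two typicality properties of a dimension bound `D₂` -/

/-- Whenever `dim H₁ = d₁ < dim H₂` and `dim H₂ > D₂`: for every orthonormal basis `b` of `H₂`,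
density operator `ρ₁` on `H₁` and bounded measurable `f ≠ 0`, at least the fraction `1 - δ` of all
`ψ ∈ 𝓡(ρ₁)` satisfies `|μ₁^{ψ,b}(f) - GAP(ρ₁)(f)| < ε ‖f‖_∞`. -/
def TypicalStateProperty (ε δ : ℝ) (d₁ : ℕ) (D₂ : ℝ) : Prop :=
  ∀ (H₁ : Type u) [NormedAddCommGroup H₁] [InnerProductSpace ℂ H₁] [FiniteDimensional ℂ H₁]
    [MeasurableSpace H₁] [BorelSpace H₁]
    (H₂ : Type v) [NormedAddCommGroup H₂] [InnerProductSpace ℂ H₂] [FiniteDimensional ℂ H₂]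
    [CompleteSpace H₂] [MeasurableSpace H₂] [BorelSpace H₂],
    finrank ℂ H₁ = d₁ → ∀ hd : finrank ℂ H₁ < finrank ℂ H₂, D₂ < (finrank ℂ H₂ : ℝ) →
    ∀ (b : OrthonormalBasis (Fin (finrank ℂ H₂)) ℂ H₂)
      (ρ₁ : H₁ →ₗ[ℂ] H₁) (hρ : IsDensityOperator ρ₁)
      (f : Metric.sphere (0 : H₁) 1 → ℝ), Measurable f → (∃ C, ∀ x, |f x| ≤ C) → f ≠ 0 →
      ENNReal.ofReal (1 - δ) ≤ uniformState ρ₁ hρ.isPositive.isSymmetric hd.le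
        {ψ : H₁ ⊗[ℂ] H₂ | ψ ∈ stateSet ρ₁ ∧
          |∫ x, f x ∂(condMeasure ψ b) - ∫ x, f x ∂(gapMeasure ρ₁ hρ.isPositive.isSymmetric)|
            < ε * supNorm f}

/-- Whenever `dim H₁ = d₁ < dim H₂` and `dim H₂ > D₂`: for every unit vector `ψ ∈ H₁ ⊗ H₂` and
bounded measurable `f ≠ 0`, at least the fraction `1 - δ` of all orthonormal bases `b` of `H₂`
satisfies `|μ₁^{ψ,b}(f) - GAP(ρ₁^ψ)(f)| < ε ‖f‖_∞`. -/
def TypicalBasisProperty (ε δ : ℝ) (d₁ : ℕ) (D₂ : ℝ) : Prop :=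
  ∀ (H₁ : Type u) [NormedAddCommGroup H₁] [InnerProductSpace ℂ H₁] [FiniteDimensional ℂ H₁]
    [MeasurableSpace H₁] [BorelSpace H₁]
    (H₂ : Type v) [NormedAddCommGroup H₂] [InnerProductSpace ℂ H₂] [FiniteDimensional ℂ H₂]
    [CompleteSpace H₂] [MeasurableSpace H₂] [BorelSpace H₂],
    finrank ℂ H₁ = d₁ → finrank ℂ H₁ < finrank ℂ H₂ → D₂ < (finrank ℂ H₂ : ℝ) →
    ∀ (ψ : H₁ ⊗[ℂ] H₂), ‖ψ‖ = 1 →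
    ∀ (f : Metric.sphere (0 : H₁) 1 → ℝ), Measurable f → (∃ C, ∀ x, |f x| ≤ C) → f ≠ 0 →
      ENNReal.ofReal (1 - δ) ≤ uniformONB H₂
        {b : OrthonormalBasis (Fin (finrank ℂ H₂)) ℂ H₂ |
          |∫ x, f x ∂(condMeasure ψ b) -
              ∫ x, f x ∂(gapMeasure (reducedDensity ψ) (reducedDensity_isSymmetric ψ))|
            < ε * supNorm f}

end

set_option linter.unusedSectionVars false

noncomputable section

/-! ### Standard complex Gaussian vectors -/

/-! Extend `f` to `radialExt f x = ‖x‖² f (x / ‖x‖)`. The weights `‖⟨b_j|ψ⟩‖²` and the density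
`‖ψ‖²` in `GA` then disappear: `μ₁^{ψ,b}(f)` is the sum of `radialExt f` over the vectors `⟨b_j|ψ⟩`,
and `GAP(ρ)(f)` is the mean of `radialExt f` under `G(ρ)`. For `ψ` in Schmidt form, `⟨y|ψ⟩ = T y`
with `T` antilinear, and `T` maps the standard Gaussian `g` of `H₂` to `G(ρ₁)`
(`stdComplexGaussian_map_antilinearMap`). With `F = radialExt f ∘ T`, both properties say that `∑ j,
F (U b_j)` is close to `𝔼 F(g)` for most Haar unitaries `U`.

The mean is exactly right: `F` is homogeneous of degree two and `𝔼‖g‖² = n`, where `n = dim H₂`, so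
`n 𝔼 F(U b_j) = 𝔼 F(g)` (`lintegral_sum_haarUnitary`). For the variance, given `u = U b_i` the
vector `U b_j` is uniform on the unit sphere of `uᗮ`, so the correlation of `F(U b_i)` and `F(U
b_j)` is expressed by `𝔼 F(R g)`, where `R` projects onto `uᗮ`. Now `F` sees only the projection `P`
onto the span `S` of the `d₁` Schmidt vectors, and `P R g` differs from `P g` only by a contraction
in the direction `P u`. The density of the contracted Gaussian is at most `(1 - ‖P u‖²)⁻¹` times the
original one (`lintegral_orthogonal_le_mul`). Since `𝔼‖P u‖⁴` is of order `n⁻²`, the variance is at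
most a constant depending on `d₁`, divided by `n` (`lintegral_sum_sq_haarUnitary_le`), and
Chebyshev's inequality gives (A).

For (A) implies (B), rotating the Schmidt vectors by `U` has the same effect on the partial inner
products as rotating the basis by `U⁻¹`. Every `ψ` has a Schmidt form in the chosen eigenbasis of
its reduced density matrix (`exists_schmidt_basis`), so invariance of Haar measure under inversion
and right translation turns one statement into the other with the same `D₂`. -/

instance complexGaussian_isProbabilityMeasure (p : ℝ) :
    IsProbabilityMeasure (complexGaussian p) :=
  Measure.isProbabilityMeasure_map (by fun_prop)

theorem charFun_complexGaussian_one (t : ℂ) :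
    charFun (complexGaussian 1) t = Complex.exp (-((‖t‖ : ℂ) ^ 2) / 4) := by
  have hre (x : ℝ × ℝ) : inner ℝ ((x.1 : ℂ) + (x.2 : ℂ) * Complex.I) t =
      x.1 * t.re + x.2 * t.im := by
    simp [Complex.inner, mul_comm]
  rw [charFun_apply, complexGaussian, integral_map (by fun_prop) (by fun_prop)]
  have h2 (x : ℝ × ℝ) :
      Complex.exp ((inner ℝ ((x.1 : ℂ) + (x.2 : ℂ) * Complex.I) t : ℝ) * Complex.I) =
      Complex.exp ((inner ℝ x.1 t.re : ℝ) * Complex.I) *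
        Complex.exp ((inner ℝ x.2 t.im : ℝ) * Complex.I) := by
    rw [hre, ← Complex.exp_add]
    rw [show inner ℝ x.1 t.re = x.1 * t.re by simp [mul_comm],
      show inner ℝ x.2 t.im = x.2 * t.im by simp [mul_comm]]
    push_cast
    ring_nf
  simp_rw [h2]
  rw [integral_prod_mul (fun x : ℝ => Complex.exp ((inner ℝ x t.re : ℝ) * Complex.I))
    (fun x : ℝ => Complex.exp ((inner ℝ x t.im : ℝ) * Complex.I)), ← charFun_apply,
    ← charFun_apply, charFun_gaussianReal, charFun_gaussianReal, ← Complex.exp_add]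
  congr 1
  have h3 : ((‖t‖ : ℂ)) ^ 2 = (t.re : ℂ) ^ 2 + (t.im : ℂ) ^ 2 := by
    have := Complex.sq_norm t
    rw [Complex.normSq_apply] at this
    exact_mod_cast (by rw [this]; ring : ‖t‖ ^ 2 = t.re ^ 2 + t.im ^ 2)
  have h4 : (((1 / 2 : ℝ).toNNReal : ℝ) : ℂ) = 1 / 2 := by
    rw [Real.coe_toNNReal _ (by norm_num)]; norm_num
  rw [h3, h4]
  push_cast
  ring

/-- Contracting by `c` multiplies the normalising factor of the density by `c⁻¹` and only decreases
the exponential. -/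
theorem gaussianReal_map_mul_le {c : ℝ} (hc : 0 < c) (hc1 : c ≤ 1) {v : NNReal} (hv : v ≠ 0) :
    (gaussianReal 0 v).map (fun x => c * x) ≤ ENNReal.ofReal c⁻¹ • gaussianReal 0 v := by
  have hw : (NNReal.mk (c ^ 2) (sq_nonneg c) * v) ≠ 0 := by
    refine mul_ne_zero (fun h => ?_) hv
    have := congrArg NNReal.toReal h
    simp [hc.ne'] at this
  rw [gaussianReal_map_const_mul, mul_zero, gaussianReal_of_var_ne_zero _ hv,
    gaussianReal_of_var_ne_zero _ hw, ← withDensity_smul _ (by fun_prop)]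
  refine withDensity_mono (Filter.Eventually.of_forall fun x => ?_)
  simp only [Pi.smul_apply, smul_eq_mul, gaussianPDF]
  rw [← ENNReal.ofReal_mul (by positivity)]
  refine ENNReal.ofReal_le_ofReal ?_
  simp only [gaussianPDFReal, NNReal.coe_mul, NNReal.coe_mk, sub_zero]
  have hv0 : 0 < (v : ℝ) := by positivity
  have h1 : (√(2 * Real.pi * (c ^ 2 * v)))⁻¹ = c⁻¹ * (√(2 * Real.pi * v))⁻¹ := by
    rw [show 2 * Real.pi * (c ^ 2 * v) = c ^ 2 * (2 * Real.pi * v) by ring,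
      Real.sqrt_mul (by positivity), Real.sqrt_sq hc.le, mul_inv]
  rw [h1, mul_assoc]
  gcongr 3
  rw [neg_div, neg_div, neg_le_neg_iff]
  refine div_le_div_of_nonneg_left (sq_nonneg _) (by positivity) ?_
  have : c ^ 2 ≤ 1 := by nlinarith
  nlinarith

theorem complexGaussian_map_mul_le {c : ℝ} (hc : 0 < c) (hc1 : c ≤ 1) :
    (complexGaussian 1).map (fun z => (c : ℂ) * z) ≤
      ENNReal.ofReal (c ^ 2)⁻¹ • complexGaussian 1 := by
  set μ := gaussianReal 0 (1 / 2 : ℝ).toNNReal with hμ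
  have hv : (1 / 2 : ℝ).toNNReal ≠ 0 := by simp
  have h := gaussianReal_map_mul_le hc hc1 hv
  rw [← hμ] at h
  have h1 : ((μ.prod μ).map fun z : ℝ × ℝ => (c * z.1, c * z.2)) ≤
      ENNReal.ofReal (c ^ 2)⁻¹ • μ.prod μ := by
    have h2 := Measure.map_prod_map μ μ (f := fun x => c * x) (g := fun x => c * x)
      (by fun_prop) (by fun_prop)
    change Measure.map (Prod.map _ _) _ ≤ _
    rw [← h2]
    refine (Measure.prod_mono h h).trans ?_
    rw [Measure.prod_smul_left, Measure.prod_smul_right, smul_smul, ← ENNReal.ofReal_mul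
      (by positivity), ← mul_inv, ← sq]
  have h3 := Measure.map_mono h1
    (show Measurable (fun z : ℝ × ℝ => (z.1 : ℂ) + (z.2 : ℂ) * Complex.I) by fun_prop)
  rw [Measure.map_smul, Measure.map_map (by fun_prop) (by fun_prop)] at h3
  rw [complexGaussian, Measure.map_map (by fun_prop) (by fun_prop)]
  convert h3 using 2
  ext z
  simp [mul_add, mul_assoc]

/-! ### Gaussian vectors and their covariance forms; moments of one complex Gaussian. -/

section GaussLaw

variable {ι κ : Type*} [Fintype ι] [Fintype κ]
variable {H : Type*} [NormedAddCommGroup H] [InnerProductSpace ℂ H] [FiniteDimensional ℂ H]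
  [MeasurableSpace H] [BorelSpace H]
variable {H' : Type*} [NormedAddCommGroup H'] [InnerProductSpace ℂ H'] [FiniteDimensional ℂ H']
  [MeasurableSpace H'] [BorelSpace H']

/-- The law of `∑ i, Z i • c i` for independent standard complex Gaussians `Z i`. -/
def gaussLaw (c : ι → H) : Measure H :=
  (Measure.pi fun _ : ι => complexGaussian 1).map (fun z => ∑ i, z i • c i)

theorem measurable_sum_smul (c : ι → H) : Measurable (fun z : ι → ℂ => ∑ i, z i • c i) :=
  Continuous.measurable (by fun_prop)

instance (c : ι → H) : IsProbabilityMeasure (gaussLaw c) :=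
  Measure.isProbabilityMeasure_map (measurable_sum_smul c).aemeasurable

theorem secondCountable_of_finiteDimensional (E : Type*) [NormedAddCommGroup E]
    [InnerProductSpace ℂ E] [FiniteDimensional ℂ E] : SecondCountableTopology E :=
  have := FiniteDimensional.proper ℂ E
  inferInstance

section CharFun

attribute [local instance] InnerProductSpace.complexToReal

theorem charFun_gaussLaw (c : ι → H) (t : H) :
    charFun (gaussLaw c) t = Complex.exp (-((∑ i, ‖inner ℂ (c i) t‖ ^ 2 : ℝ) : ℂ) / 4) := by
  have := secondCountable_of_finiteDimensional H
  rw [charFun_apply, gaussLaw, integral_map (measurable_sum_smul c).aemeasurable (by fun_prop)]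
  have h1 (z : ι → ℂ) : Complex.exp ((inner ℝ (∑ i, z i • c i) t : ℝ) * Complex.I) =
      ∏ i, Complex.exp ((inner ℝ (z i) (inner ℂ (c i) t) : ℝ) * Complex.I) := by
    rw [← Complex.exp_sum, ← Finset.sum_mul, sum_inner, Complex.ofReal_sum]
    congr 3
    refine funext fun i => ?_
    rw [real_inner_eq_re_inner ℂ, inner_smul_left, Complex.inner]
    simp [mul_comm]
  simp_rw [h1]
  rw [integral_fintype_prod_eq_prod
    (fun i (z : ℂ) => Complex.exp ((inner ℝ z (inner ℂ (c i) t) : ℝ) * Complex.I))]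
  simp_rw [← charFun_apply, charFun_complexGaussian_one, ← Complex.exp_sum]
  congr 1
  push_cast
  rw [← Finset.sum_div, Finset.sum_neg_distrib]

/-- The characteristic function depends on the generating vectors only through their quadratic form;
the two families may have different sizes. -/
theorem gaussLaw_eq_of_form {c : ι → H} {c' : κ → H}
    (h : ∀ t, ∑ i, ‖inner ℂ (c i) t‖ ^ 2 = ∑ k, ‖inner ℂ (c' k) t‖ ^ 2) :
    gaussLaw c = gaussLaw c' := by
  have := secondCountable_of_finiteDimensional H
  have := FiniteDimensional.complete ℂ H
  refine Measure.ext_of_charFun (funext fun t => ?_)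
  rw [charFun_gaussLaw, charFun_gaussLaw, h]

/-- Covariance forms add under convolution. This splits off one direction `w`, so that it can be
rescaled while the rest stays fixed. -/
theorem gaussLaw_eq_conv_of_form {c : ι → H} {c' : κ → H} {w : H}
    (h : ∀ t, ∑ i, ‖inner ℂ (c i) t‖ ^ 2 = ‖inner ℂ w t‖ ^ 2 + ∑ k, ‖inner ℂ (c' k) t‖ ^ 2) :
    gaussLaw c = (gaussLaw fun _ : Unit => w) ∗ gaussLaw c' := by
  have := secondCountable_of_finiteDimensional H
  have := FiniteDimensional.complete ℂ H
  refine Measure.ext_of_charFun (funext fun t => ?_)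
  rw [charFun_conv, charFun_gaussLaw, charFun_gaussLaw, charFun_gaussLaw, h, ← Complex.exp_add]
  congr 1
  simp
  ring

end CharFun

theorem gaussLaw_map (c : ι → H) (L : H →L[ℂ] H') :
    (gaussLaw c).map L = gaussLaw fun i => L (c i) := by
  rw [gaussLaw, gaussLaw, Measure.map_map L.continuous.measurable (measurable_sum_smul c)]
  congr 1
  ext z
  simp

theorem gaussLaw_unit (w : H) :
    gaussLaw (fun _ : Unit => w) = (complexGaussian 1).map (fun z => z • w) := by
  have h := (measurePreserving_eval (fun _ : Unit => complexGaussian 1) ()).map_eq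
  rw [← h, Measure.map_map (Continuous.measurable (by fun_prop)) (by fun_prop), gaussLaw]
  congr 1
  ext z
  simp

theorem gaussLaw_smul_le (w : H) {b : ℝ} (hb : 0 < b) (hb1 : b ≤ 1) :
    gaussLaw (fun _ : Unit => (b : ℂ) • w) ≤
      ENNReal.ofReal (b ^ 2)⁻¹ • gaussLaw (fun _ : Unit => w) := by
  have hm : Measurable fun z : ℂ => z • w := Continuous.measurable (by fun_prop)
  have h := Measure.map_mono (complexGaussian_map_mul_le hb hb1) hm
  rw [Measure.map_smul, Measure.map_map hm (by fun_prop)] at h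
  rw [gaussLaw_unit, gaussLaw_unit]
  convert h using 2
  ext z
  simp only [Function.comp_apply, smul_smul, mul_comm]

theorem lintegral_sq_gaussianReal (v : NNReal) :
    ∫⁻ x, ENNReal.ofReal (x ^ 2) ∂gaussianReal 0 v = v := by
  have hi : Integrable (fun x : ℝ => x ^ 2) (gaussianReal 0 v) :=
    (memLp_id_gaussianReal 2).integrable_sq
  have hvar := variance_fun_id_gaussianReal (μ := 0) (v := v)
  rw [variance_eq_integral (by fun_prop)] at hvar
  simp only [integral_id_gaussianReal, sub_zero] at hvar
  rw [← ofReal_integral_eq_lintegral_ofReal hi (Filter.Eventually.of_forall fun _ => sq_nonneg _),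
    hvar, ENNReal.ofReal_coe_nnreal]

theorem enorm_sq_add_mul_I (x y : ℝ) :
    ‖(x : ℂ) + (y : ℂ) * Complex.I‖ₑ ^ 2 = ENNReal.ofReal (x ^ 2) + ENNReal.ofReal (y ^ 2) := by
  rw [← ofReal_norm, ← ENNReal.ofReal_pow (norm_nonneg _), Complex.sq_norm,
    Complex.normSq_add_mul_I, ENNReal.ofReal_add (sq_nonneg _) (sq_nonneg _)]

theorem lintegral_norm_sq_complexGaussian_one :
    ∫⁻ z, ‖z‖ₑ ^ 2 ∂complexGaussian 1 = 1 := by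
  rw [complexGaussian, lintegral_map (by fun_prop) (by fun_prop)]
  simp_rw [enorm_sq_add_mul_I]
  rw [lintegral_add_left (by fun_prop), lintegral_prod _ (by fun_prop),
    lintegral_prod _ (by fun_prop)]
  simp only [lintegral_const, measure_univ, mul_one, lintegral_sq_gaussianReal]
  rw [← ENNReal.coe_add, ← Real.toNNReal_add (by norm_num) (by norm_num)]
  norm_num

theorem lintegral_norm_pow_four_complexGaussian_one :
    ∫⁻ z, ‖z‖ₑ ^ 4 ∂complexGaussian 1 ≠ ∞ := by
  rw [complexGaussian, lintegral_map (by fun_prop) (by fun_prop)]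
  set v := (1 / 2 : ℝ).toNNReal
  have h4 : ∫⁻ x, ENNReal.ofReal (x ^ 4) ∂gaussianReal 0 v ≠ ∞ := by
    have hi : Integrable (fun x : ℝ => x ^ 4) (gaussianReal 0 v) := by
      have := (memLp_id_gaussianReal (μ := 0) (v := v) 4).integrable_norm_pow (by norm_num)
      refine this.congr (Filter.Eventually.of_forall fun x => ?_)
      simp [(show Even 4 by decide).pow_abs]
    rw [← ofReal_integral_eq_lintegral_ofReal hi
      (Filter.Eventually.of_forall fun _ => (show Even 4 by decide).pow_nonneg _)]
    exact ENNReal.ofReal_ne_top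
  have hle (z : ℝ × ℝ) : ‖(z.1 : ℂ) + (z.2 : ℂ) * Complex.I‖ₑ ^ 4 ≤
      2 * ENNReal.ofReal (z.1 ^ 4) + 2 * ENNReal.ofReal (z.2 ^ 4) := by
    rw [show ‖(z.1 : ℂ) + (z.2 : ℂ) * Complex.I‖ₑ ^ 4 =
      (‖(z.1 : ℂ) + (z.2 : ℂ) * Complex.I‖ₑ ^ 2) ^ 2 by ring, enorm_sq_add_mul_I,
      ← ENNReal.ofReal_add (sq_nonneg _) (sq_nonneg _), ← ENNReal.ofReal_pow (by positivity),
      show (2 : ℝ≥0∞) = ENNReal.ofReal 2 by simp, ← ENNReal.ofReal_mul (by norm_num),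
      ← ENNReal.ofReal_mul (by norm_num), ← ENNReal.ofReal_add (by positivity) (by positivity)]
    refine ENNReal.ofReal_le_ofReal ?_
    nlinarith [sq_nonneg (z.1 ^ 2 - z.2 ^ 2)]
  refine ne_top_of_le_ne_top ?_ (lintegral_mono hle)
  rw [lintegral_add_left (by fun_prop), lintegral_const_mul _ (by fun_prop),
    lintegral_const_mul _ (by fun_prop), lintegral_prod _ (by fun_prop),
    lintegral_prod _ (by fun_prop)]
  simp only [lintegral_const, measure_univ, mul_one]
  exact ENNReal.add_ne_top.2 ⟨ENNReal.mul_ne_top (by norm_num) h4,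
    ENNReal.mul_ne_top (by norm_num) h4⟩
end GaussLaw

/-! ### The standard Gaussian: invariance, projections and moments. -/

section StdGaussian

variable {ι κ : Type*} [Fintype ι] [Fintype κ]
variable (H : Type*) [NormedAddCommGroup H] [InnerProductSpace ℂ H] [FiniteDimensional ℂ H]
  [MeasurableSpace H] [BorelSpace H]

/-- The standard complex Gaussian measure on `H`, with covariance the identity. -/
def stdComplexGaussian : Measure H := gaussLaw (stdOrthonormalBasis ℂ H)

instance : IsProbabilityMeasure (stdComplexGaussian H) := by
  unfold stdComplexGaussian; infer_instance

variable {H}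

theorem stdComplexGaussian_eq_gaussLaw (b : OrthonormalBasis ι ℂ H) :
    stdComplexGaussian H = gaussLaw b :=
  gaussLaw_eq_of_form fun t => by
    rw [OrthonormalBasis.sum_sq_norm_inner_right, OrthonormalBasis.sum_sq_norm_inner_right]

theorem stdComplexGaussian_map_isometry (V : H ≃ₗᵢ[ℂ] H) :
    (stdComplexGaussian H).map V = stdComplexGaussian H := by
  calc (stdComplexGaussian H).map V = gaussLaw fun i => V (stdOrthonormalBasis ℂ H i) :=
        gaussLaw_map _ V.toContinuousLinearEquiv.toContinuousLinearMap
    _ = stdComplexGaussian H := by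
      rw [stdComplexGaussian_eq_gaussLaw ((stdOrthonormalBasis ℂ H).map V)]
      congr 1

/-- Both covariance forms at `t` equal the squared norm of the projection of `t` to `S`. Moments of
the projected vector therefore involve `finrank ℂ S` and not the dimension of `H`. -/
theorem stdComplexGaussian_map_starProjection (S : Submodule ℂ H) (e : OrthonormalBasis ι ℂ S) :
    (stdComplexGaussian H).map S.starProjection = gaussLaw fun i => (e i : H) := by
  rw [stdComplexGaussian, gaussLaw_map]
  refine gaussLaw_eq_of_form fun t => ?_
  simp_rw [Submodule.inner_starProjection_left_eq_right]
  rw [OrthonormalBasis.sum_sq_norm_inner_right]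
  have h := e.sum_sq_norm_inner_right (S.orthogonalProjectionOnto t)
  simp_rw [Submodule.coe_inner, Submodule.coe_norm] at h
  rw [Submodule.starProjection_apply, ← h]
  refine Finset.sum_congr rfl fun i _ => ?_
  rw [← Submodule.starProjection_apply, ← Submodule.inner_starProjection_left_eq_right,
    Submodule.starProjection_eq_self_iff.2 (e i).2]

theorem norm_sum_smul_sq {E : Type*} [NormedAddCommGroup E] [InnerProductSpace ℂ E] {e : ι → E}
    (he : Orthonormal ℂ e) (z : ι → ℂ) : ‖∑ i, z i • e i‖ ^ 2 = ∑ i, ‖z i‖ ^ 2 := by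
  have := he.inner_sum z z Finset.univ
  rw [← inner_self_eq_norm_sq (𝕜 := ℂ), this, map_sum]
  refine Finset.sum_congr rfl fun i _ => ?_
  rw [RCLike.conj_mul]
  norm_cast

theorem enorm_sum_smul_sq (e : ι → H) (he : Orthonormal ℂ e) (z : ι → ℂ) :
    ‖∑ i, z i • e i‖ₑ ^ 2 = ∑ i, ‖z i‖ₑ ^ 2 := by
  simp_rw [← ofReal_norm, ← ENNReal.ofReal_pow (norm_nonneg _)]
  rw [norm_sum_smul_sq he, ENNReal.ofReal_sum_of_nonneg fun _ _ => sq_nonneg _]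

theorem lintegral_gaussLaw_orthonormal_sq (e : ι → H) (he : Orthonormal ℂ e) :
    ∫⁻ x, ‖x‖ₑ ^ 2 ∂gaussLaw e = Fintype.card ι := by
  rw [gaussLaw, lintegral_map (by fun_prop) (measurable_sum_smul e)]
  simp_rw [enorm_sum_smul_sq e he]
  rw [lintegral_finsetSum _ fun i _ => by fun_prop]
  have h (i : ι) : ∫⁻ z : ι → ℂ, ‖z i‖ₑ ^ 2 ∂Measure.pi (fun _ : ι => complexGaussian 1) = 1 := by
    have := (measurePreserving_eval (fun _ : ι => complexGaussian 1) i).lintegral_comp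
      (f := fun z => ‖z‖ₑ ^ 2) (by fun_prop)
    exact this.trans lintegral_norm_sq_complexGaussian_one
  simp [h]

theorem lintegral_gaussLaw_orthonormal_pow_four (e : ι → H) (he : Orthonormal ℂ e) :
    ∫⁻ x, ‖x‖ₑ ^ 4 ∂gaussLaw e ≤
      (Fintype.card ι) ^ 2 * ∫⁻ z, ‖z‖ₑ ^ 4 ∂complexGaussian 1 := by
  rw [gaussLaw, lintegral_map (by fun_prop) (measurable_sum_smul e)]
  -- Cauchy–Schwarz for `∑ i, ‖z i‖²`; a sharp constant is not needed.
  have hle (z : ι → ℂ) : ‖∑ i, z i • e i‖ₑ ^ 4 ≤ Fintype.card ι * ∑ i, ‖z i‖ₑ ^ 4 := by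
    have h := sq_sum_le_card_mul_sum_sq (s := Finset.univ) (f := fun i => ‖z i‖₊ ^ 2)
    simp_rw [← pow_mul] at h
    rw [show (4 : ℕ) = 2 * 2 from rfl, pow_mul, enorm_sum_smul_sq e he]
    simp_rw [enorm_eq_nnnorm]
    exact_mod_cast h
  refine (lintegral_mono hle).trans ?_
  rw [lintegral_const_mul _ (by fun_prop), lintegral_finsetSum _ fun i _ => by fun_prop]
  have h (i : ι) : ∫⁻ z : ι → ℂ, ‖z i‖ₑ ^ 4 ∂Measure.pi (fun _ : ι => complexGaussian 1) =
      ∫⁻ z, ‖z‖ₑ ^ 4 ∂complexGaussian 1 :=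
    (measurePreserving_eval (fun _ : ι => complexGaussian 1) i).lintegral_comp
      (f := fun z => ‖z‖ₑ ^ 4) (by fun_prop)
  simp [h, sq, mul_assoc]

theorem lintegral_starProjection_sq (S : Submodule ℂ H) :
    ∫⁻ x, ‖S.starProjection x‖ₑ ^ 2 ∂stdComplexGaussian H = finrank ℂ S := by
  have h := stdComplexGaussian_map_starProjection S (stdOrthonormalBasis ℂ S)
  have h2 := lintegral_gaussLaw_orthonormal_sq _
    ((stdOrthonormalBasis ℂ S).orthonormal.comp_linearIsometry S.subtypeₗᵢ)
  rw [Fintype.card_fin] at h2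
  rw [← h2]
  change _ = ∫⁻ x, ‖x‖ₑ ^ 2 ∂gaussLaw fun i => (stdOrthonormalBasis ℂ S i : H)
  rw [← h, lintegral_map (by fun_prop) (by fun_prop)]

theorem lintegral_starProjection_pow_four (S : Submodule ℂ H) :
    ∫⁻ x, ‖S.starProjection x‖ₑ ^ 4 ∂stdComplexGaussian H ≤
      finrank ℂ S ^ 2 * ∫⁻ z, ‖z‖ₑ ^ 4 ∂complexGaussian 1 := by
  have h := stdComplexGaussian_map_starProjection S (stdOrthonormalBasis ℂ S)
  have h2 := lintegral_gaussLaw_orthonormal_pow_four _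
    ((stdOrthonormalBasis ℂ S).orthonormal.comp_linearIsometry S.subtypeₗᵢ)
  rw [Fintype.card_fin] at h2
  refine le_trans (le_of_eq ?_) h2
  change _ = ∫⁻ x, ‖x‖ₑ ^ 4 ∂gaussLaw fun i => (stdOrthonormalBasis ℂ S i : H)
  rw [← h, lintegral_map (by fun_prop) (by fun_prop)]

theorem lintegral_norm_sq_stdComplexGaussian :
    ∫⁻ x, ‖x‖ₑ ^ 2 ∂stdComplexGaussian H = finrank ℂ H := by
  rw [stdComplexGaussian, lintegral_gaussLaw_orthonormal_sq _
    (stdOrthonormalBasis ℂ H).orthonormal, Fintype.card_fin]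

/-- Jensen's inequality for `‖x‖²`, whose mean is the dimension, obtained from Hölder's inequality
with the constant function `1`. -/
theorem sq_le_lintegral_norm_pow_four :
    (finrank ℂ H : ℝ≥0∞) ^ 2 ≤ ∫⁻ x, ‖x‖ₑ ^ 4 ∂stdComplexGaussian H := by
  rw [← lintegral_norm_sq_stdComplexGaussian (H := H)]
  have h := ENNReal.lintegral_mul_le_Lp_mul_Lq (stdComplexGaussian H) .two_two
    (f := fun x => ‖x‖ₑ ^ 2) (g := fun _ => 1) (by fun_prop) (by fun_prop)
  simp only [Pi.mul_apply, mul_one, ENNReal.rpow_ofNat, ← pow_mul, one_pow, lintegral_const,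
    measure_univ, ENNReal.one_rpow] at h
  calc (∫⁻ x, ‖x‖ₑ ^ 2 ∂stdComplexGaussian H) ^ 2
      ≤ ((∫⁻ x, ‖x‖ₑ ^ (2 * 2) ∂stdComplexGaussian H) ^ (1 / 2 : ℝ)) ^ 2 := by gcongr
    _ = ∫⁻ x, ‖x‖ₑ ^ 4 ∂stdComplexGaussian H := by
      rw [← ENNReal.rpow_natCast, ← ENNReal.rpow_mul]
      norm_num

end StdGaussian

/-! ### Haar measure on the unitary group -/

section Haar

/-! ### The Haar probability measure of a compact group. -/

section Group

variable {G : Type*} [Group G] [TopologicalSpace G] [IsTopologicalGroup G] [CompactSpace G]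
  [MeasurableSpace G] [BorelSpace G]

theorem haarMeasure_top_isProbabilityMeasure :
    IsProbabilityMeasure (Measure.haarMeasure (⊤ : TopologicalSpace.PositiveCompacts G)) :=
  ⟨by simpa using Measure.haarMeasure_self (K₀ := (⊤ : TopologicalSpace.PositiveCompacts G))⟩

theorem haarMeasure_top_map_mul_right (g : G) :
    (Measure.haarMeasure (⊤ : TopologicalSpace.PositiveCompacts G)).map (· * g) =
      Measure.haarMeasure ⊤ := by
  have := haarMeasure_top_isProbabilityMeasure (G := G)
  have : IsProbabilityMeasure
      ((Measure.haarMeasure (⊤ : TopologicalSpace.PositiveCompacts G)).map (· * g)) :=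
    Measure.isProbabilityMeasure_map (measurable_mul_const g).aemeasurable
  exact Measure.isHaarMeasure_eq_of_isProbabilityMeasure _ _

/-- Right invariance makes the inverted measure left invariant, and a compact group has only one
Haar probability measure. -/
theorem haarMeasure_top_map_inv :
    (Measure.haarMeasure (⊤ : TopologicalSpace.PositiveCompacts G)).map (·⁻¹) =
      Measure.haarMeasure ⊤ := by
  have := haarMeasure_top_isProbabilityMeasure (G := G)
  have : (Measure.haarMeasure (⊤ : TopologicalSpace.PositiveCompacts G)).IsMulRightInvariant :=
    ⟨haarMeasure_top_map_mul_right⟩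
  have hp : IsProbabilityMeasure
      (Measure.haarMeasure (⊤ : TopologicalSpace.PositiveCompacts G)).inv :=
    Measure.isProbabilityMeasure_map measurable_inv.aemeasurable
  have : (Measure.haarMeasure (⊤ : TopologicalSpace.PositiveCompacts G)).inv.IsHaarMeasure :=
    Measure.isHaarMeasure_of_isCompact_nonempty_interior _ Set.univ isCompact_univ (by simp)
      (by rw [measure_univ]; exact one_ne_zero) (by rw [measure_univ]; exact ENNReal.one_ne_top)
  exact Measure.isHaarMeasure_eq_of_isProbabilityMeasure
    (Measure.haarMeasure (⊤ : TopologicalSpace.PositiveCompacts G)).inv _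

end Group

variable {H : Type*} [NormedAddCommGroup H] [InnerProductSpace ℂ H] [FiniteDimensional ℂ H]
  [CompleteSpace H]

instance : IsProbabilityMeasure (haarUnitary H) := haarMeasure_top_isProbabilityMeasure

theorem measurePreserving_mul_right_haarUnitary (V : unitary (H →L[ℂ] H)) :
    MeasurePreserving (· * V) (haarUnitary H) (haarUnitary H) :=
  ⟨measurable_mul_const V, haarMeasure_top_map_mul_right V⟩

theorem measurePreserving_inv_haarUnitary :
    MeasurePreserving (·⁻¹) (haarUnitary H) (haarUnitary H) :=
  ⟨measurable_inv, haarMeasure_top_map_inv⟩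

theorem continuous_unitary_apply :
    Continuous fun p : unitary (H →L[ℂ] H) × H => Unitary.linearIsometryEquiv p.1 p.2 := by
  have h : Continuous fun p : unitary (H →L[ℂ] H) × H => (p.1 : H →L[ℂ] H) p.2 := by fun_prop
  exact h

variable [MeasurableSpace H] [BorelSpace H]

theorem measurable_unitary_apply (x : H) :
    Measurable fun U : unitary (H →L[ℂ] H) => Unitary.linearIsometryEquiv U x := by
  have h : Continuous fun U : unitary (H →L[ℂ] H) => Unitary.linearIsometryEquiv U x :=
    continuous_unitary_apply.comp (by fun_prop : Continuous fun U => (U, x))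
  exact h.measurable

theorem measurable_unitary_apply_uncurry :
    Measurable fun p : unitary (H →L[ℂ] H) × H => Unitary.linearIsometryEquiv p.1 p.2 := by
  have := secondCountable_of_finiteDimensional H
  exact continuous_unitary_apply.measurable

theorem lintegral_haarUnitary_comp_mul (V : H ≃ₗᵢ[ℂ] H)
    {F : (H ≃ₗᵢ[ℂ] H) → ℝ≥0∞} (hF : Measurable fun U : unitary (H →L[ℂ] H) =>
      F (Unitary.linearIsometryEquiv U)) :
    ∫⁻ U, F (V.trans (Unitary.linearIsometryEquiv U)) ∂haarUnitary H =
      ∫⁻ U, F (Unitary.linearIsometryEquiv U) ∂haarUnitary H := by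
  rw [← (measurePreserving_mul_right_haarUnitary
    (Unitary.linearIsometryEquiv.symm V)).lintegral_comp hF]
  refine lintegral_congr fun U => ?_
  rw [map_mul, MulEquiv.apply_symm_apply]
  rfl

/-- An isometry that maps given members of an orthonormal basis to given orthonormal vectors. -/
theorem exists_isometry_of_orthonormal {ι : Type*} [Fintype ι] (b : OrthonormalBasis ι ℂ H)
    {v : ι → H} {s : Set ι} (hv : Orthonormal ℂ (s.domRestrict v)) :
    ∃ V : H ≃ₗᵢ[ℂ] H, ∀ i ∈ s, V (b i) = v i := by
  obtain ⟨b', hb'⟩ := hv.exists_orthonormalBasis_extension_of_card_eq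
    (by rw [finrank_eq_card_basis b.toBasis])
  refine ⟨b.equiv b' (Equiv.refl ι), fun i hi => ?_⟩
  simp [hb' i hi]

theorem exists_isometry_apply_eq {ι : Type*} [Fintype ι] (b : OrthonormalBasis ι ℂ H) (i : ι)
    {x : H} (hx : ‖x‖ = 1) : ∃ V : H ≃ₗᵢ[ℂ] H, V (b i) = x := by
  have hv : Orthonormal ℂ (({i} : Set ι).domRestrict fun _ => x) := by
    refine ⟨fun _ => hx, fun a b hab => ?_⟩
    exact absurd (Subtype.ext (a.2.trans b.2.symm)) hab
  obtain ⟨V, hV⟩ := exists_isometry_of_orthonormal b hv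
  exact ⟨V, hV i rfl⟩

theorem exists_isometry_apply_eq_pair {ι : Type*} [Fintype ι] (b : OrthonormalBasis ι ℂ H)
    {i j : ι} (hij : i ≠ j) {x y : H} (hx : ‖x‖ = 1) (hy : ‖y‖ = 1) (hxy : inner ℂ x y = 0) :
    ∃ V : H ≃ₗᵢ[ℂ] H, V (b i) = x ∧ V (b j) = y := by
  classical
  have hv : Orthonormal ℂ (({i, j} : Set ι).domRestrict fun k => if k = i then x else y) := by
    refine ⟨fun k => ?_, fun k l hkl => ?_⟩
    · by_cases h : (k : ι) = i <;> simp [h, hx, hy]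
    · obtain ⟨k, rfl | rfl⟩ := k <;> obtain ⟨l, rfl | rfl⟩ := l
      · exact absurd rfl hkl
      · simpa [hij.symm] using hxy
      · simpa [hij.symm] using inner_eq_zero_symm.1 hxy
      · exact absurd rfl hkl
  obtain ⟨V, hV⟩ := exists_isometry_of_orthonormal b hv
  exact ⟨V, by simpa using hV i (by simp), by simpa [hij.symm] using hV j (by simp)⟩

/-- A nonnegative function is homogeneous of degree `k` for scaling by nonnegative reals. -/
def IsRealHomogeneous (k : ℕ) (F : H → ℝ≥0∞) : Prop :=
  ∀ (c : ℝ) (x : H), 0 ≤ c → F ((c : ℂ) • x) = ENNReal.ofReal c ^ k * F x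

/-- The unitary group is transitive on unit vectors, so by right invariance the direction of `x` is
irrelevant; homogeneity extracts its norm. -/
theorem lintegral_haarUnitary_homogeneous {ι : Type*} [Fintype ι] (b : OrthonormalBasis ι ℂ H)
    (i : ι) {k : ℕ} {F : H → ℝ≥0∞} (hF : Measurable F) (hk : IsRealHomogeneous k F) (x : H) :
    ∫⁻ U, F (Unitary.linearIsometryEquiv U x) ∂haarUnitary H =
      ‖x‖ₑ ^ k * ∫⁻ U, F (Unitary.linearIsometryEquiv U (b i)) ∂haarUnitary H := by
  have hunit : ∃ y : H, ‖y‖ = 1 ∧ x = ((‖x‖ : ℝ) : ℂ) • y := by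
    by_cases hx : x = 0
    · exact ⟨b i, b.norm_eq_one i, by simp [hx]⟩
    · refine ⟨((‖x‖⁻¹ : ℝ) : ℂ) • x, by simp [norm_smul, hx], ?_⟩
      rw [smul_smul, ← Complex.ofReal_mul, mul_inv_cancel₀ (norm_ne_zero_iff.2 hx)]
      simp
  obtain ⟨y, hy, hxy⟩ := hunit
  obtain ⟨V, hV⟩ := exists_isometry_apply_eq b i hy
  have hm (z : H) : Measurable fun U : unitary (H →L[ℂ] H) =>
      F (Unitary.linearIsometryEquiv U z) := hF.comp (measurable_unitary_apply z)
  have h1 := lintegral_haarUnitary_comp_mul V (F := fun W => F (W (b i))) (hm _)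
  rw [← h1]
  simp only [LinearIsometryEquiv.trans_apply, hV]
  rw [← lintegral_const_mul _ (hm _)]
  refine lintegral_congr fun U => ?_
  nth_rw 1 [hxy]
  rw [map_smul, hk _ _ (norm_nonneg _), ofReal_norm]

theorem lintegral_stdComplexGaussian_comp_unitary {F : H → ℝ≥0∞} (hF : Measurable F)
    (V : H ≃ₗᵢ[ℂ] H) :
    ∫⁻ x, F (V x) ∂stdComplexGaussian H = ∫⁻ x, F x ∂stdComplexGaussian H := by
  conv_rhs => rw [← stdComplexGaussian_map_isometry V]
  rw [lintegral_map hF V.continuous.measurable]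

/-- Averages over the unitary group of homogeneous functions are Gaussian averages. -/
theorem lintegral_stdComplexGaussian_homogeneous {ι : Type*} [Fintype ι]
    (b : OrthonormalBasis ι ℂ H) (i : ι) {k : ℕ} {F : H → ℝ≥0∞} (hF : Measurable F)
    (hk : IsRealHomogeneous k F) :
    ∫⁻ x, F x ∂stdComplexGaussian H = (∫⁻ x, ‖x‖ₑ ^ k ∂stdComplexGaussian H) *
      ∫⁻ U, F (Unitary.linearIsometryEquiv U (b i)) ∂haarUnitary H := by
  -- Unitary invariance of the Gaussian allows a Haar average to be inserted; after Tonelli the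
  -- inner average depends on `x` only through `‖x‖`.
  calc ∫⁻ x, F x ∂stdComplexGaussian H
      = ∫⁻ U, ∫⁻ x, F (Unitary.linearIsometryEquiv U x) ∂stdComplexGaussian H ∂haarUnitary H := by
        rw [lintegral_congr fun U =>
          lintegral_stdComplexGaussian_comp_unitary hF (Unitary.linearIsometryEquiv U)]
        simp
    _ = ∫⁻ x, ∫⁻ U, F (Unitary.linearIsometryEquiv U x) ∂haarUnitary H ∂stdComplexGaussian H :=
        lintegral_lintegral_swap (hF.comp measurable_unitary_apply_uncurry).aemeasurable
    _ = _ := by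
        rw [lintegral_congr fun x => lintegral_haarUnitary_homogeneous b i hF hk x]
        rw [lintegral_mul_const _ (by fun_prop)]

/-- The version for two vectors: the unitary group is transitive on orthonormal pairs, so `x / ‖x‖`
may be replaced by `b j`. -/
theorem lintegral_haarUnitary_pair {ι : Type*} [Fintype ι] (b : OrthonormalBasis ι ℂ H)
    {i j : ι} (hij : i ≠ j) {F : H → ℝ≥0∞} (hF : Measurable F) (hk : IsRealHomogeneous 2 F)
    {x : H} (hx : inner ℂ (b i) x = 0) :
    ∫⁻ U, F (Unitary.linearIsometryEquiv U (b i)) * F (Unitary.linearIsometryEquiv U x)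
        ∂haarUnitary H =
      ‖x‖ₑ ^ 2 * ∫⁻ U, F (Unitary.linearIsometryEquiv U (b i)) *
        F (Unitary.linearIsometryEquiv U (b j)) ∂haarUnitary H := by
  have hunit : ∃ y : H, ‖y‖ = 1 ∧ inner ℂ (b i) y = 0 ∧ x = ((‖x‖ : ℝ) : ℂ) • y := by
    by_cases h0 : x = 0
    · exact ⟨b j, b.norm_eq_one j, b.inner_eq_zero hij, by simp [h0]⟩
    · refine ⟨((‖x‖⁻¹ : ℝ) : ℂ) • x, by simp [norm_smul, h0], by
        rw [inner_smul_right, hx, mul_zero], ?_⟩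
      rw [smul_smul, ← Complex.ofReal_mul, mul_inv_cancel₀ (norm_ne_zero_iff.2 h0)]
      simp
  obtain ⟨y, hy, hby, hxy⟩ := hunit
  obtain ⟨V, hVi, hVj⟩ := exists_isometry_apply_eq_pair b hij (b.norm_eq_one i) hy hby
  have hm (z : H) : Measurable fun U : unitary (H →L[ℂ] H) =>
      F (Unitary.linearIsometryEquiv U z) := hF.comp (measurable_unitary_apply z)
  have h1 := lintegral_haarUnitary_comp_mul V (F := fun W => F (W (b i)) * F (W (b j)))
    ((hm _).mul (hm _))
  rw [← h1]
  simp only [LinearIsometryEquiv.trans_apply, hVi, hVj]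
  refine Eq.trans ?_ (lintegral_const_mul (‖x‖ₑ ^ 2) ((hm (b i)).mul (hm y)))
  refine lintegral_congr fun U => ?_
  nth_rw 1 [hxy]
  rw [map_smul, hk _ _ (norm_nonneg _), ofReal_norm]
  ring

theorem starProjection_orthogonal_singleton (u x : H) (hu : ‖u‖ = 1) :
    (ℂ ∙ u)ᗮ.starProjection x = x - inner ℂ u x • u := by
  rw [Submodule.starProjection_orthogonal_val, Submodule.starProjection_unit_singleton ℂ hu]

theorem map_starProjection_orthogonal_singleton (V : H ≃ₗᵢ[ℂ] H) (u x : H) (hu : ‖u‖ = 1) :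
    (ℂ ∙ V u)ᗮ.starProjection (V x) = V ((ℂ ∙ u)ᗮ.starProjection x) := by
  rw [starProjection_orthogonal_singleton _ _ hu,
    starProjection_orthogonal_singleton _ _ (by rw [V.norm_map, hu])]
  simp

/-- The correlation of a homogeneous function at two members of a random orthonormal basis, in
terms of a Gaussian vector in the orthogonal complement of the first one. -/
theorem lintegral_haarUnitary_mul_gaussian_orthogonal {ι : Type*} [Fintype ι]
    (b : OrthonormalBasis ι ℂ H) {i j : ι} (hij : i ≠ j) {F : H → ℝ≥0∞} (hF : Measurable F)
    (hk : IsRealHomogeneous 2 F) :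
    ∫⁻ U, F (Unitary.linearIsometryEquiv U (b i)) * ∫⁻ x,
        F ((ℂ ∙ Unitary.linearIsometryEquiv U (b i))ᗮ.starProjection x) ∂stdComplexGaussian H
        ∂haarUnitary H =
      (Fintype.card ι - 1 : ℕ) * ∫⁻ U, F (Unitary.linearIsometryEquiv U (b i)) *
        F (Unitary.linearIsometryEquiv U (b j)) ∂haarUnitary H := by
  set R := (ℂ ∙ b i)ᗮ.starProjection with hR
  have hm (z : H) : Measurable fun U : unitary (H →L[ℂ] H) =>
      F (Unitary.linearIsometryEquiv U z) := hF.comp (measurable_unitary_apply z)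
  have hmR (U : unitary (H →L[ℂ] H)) :
      Measurable fun x => F (Unitary.linearIsometryEquiv U (R x)) :=
    hF.comp ((Unitary.linearIsometryEquiv U).continuous.measurable.comp R.continuous.measurable)
  have h1 (U : unitary (H →L[ℂ] H)) :
      ∫⁻ x, F ((ℂ ∙ Unitary.linearIsometryEquiv U (b i))ᗮ.starProjection x)
        ∂stdComplexGaussian H =
      ∫⁻ x, F (Unitary.linearIsometryEquiv U (R x)) ∂stdComplexGaussian H := by
    have hm' : Measurable fun x =>
        F ((ℂ ∙ Unitary.linearIsometryEquiv U (b i))ᗮ.starProjection x) :=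
      hF.comp (ContinuousLinearMap.continuous _).measurable
    -- Substituting `U x` for `x` turns the projection that depends on `U` into the fixed `R`
    -- followed by `U`, which makes Tonelli useful.
    rw [← lintegral_stdComplexGaussian_comp_unitary hm' (Unitary.linearIsometryEquiv U)]
    refine lintegral_congr fun x => ?_
    rw [map_starProjection_orthogonal_singleton _ _ _ (b.norm_eq_one i)]
  calc _ = ∫⁻ U, ∫⁻ x, F (Unitary.linearIsometryEquiv U (b i)) *
        F (Unitary.linearIsometryEquiv U (R x)) ∂stdComplexGaussian H ∂haarUnitary H := by
        refine lintegral_congr fun U => ?_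
        rw [h1, lintegral_const_mul _ (hmR U)]
    _ = ∫⁻ x, ∫⁻ U, F (Unitary.linearIsometryEquiv U (b i)) *
        F (Unitary.linearIsometryEquiv U (R x)) ∂haarUnitary H ∂stdComplexGaussian H := by
        refine lintegral_lintegral_swap (Measurable.aemeasurable ?_)
        refine ((hm (b i)).comp measurable_fst).mul (hF.comp ?_)
        exact measurable_unitary_apply_uncurry.comp
          (measurable_fst.prodMk (R.continuous.measurable.comp measurable_snd))
    _ = ∫⁻ x, ‖R x‖ₑ ^ 2 * ∫⁻ U, F (Unitary.linearIsometryEquiv U (b i)) *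
        F (Unitary.linearIsometryEquiv U (b j)) ∂haarUnitary H ∂stdComplexGaussian H := by
        refine lintegral_congr fun x => ?_
        -- `R x` is orthogonal to `b i`. Its mean squared norm is the dimension of the complement,
        -- hence the factor `Fintype.card ι - 1`.
        refine lintegral_haarUnitary_pair b hij hF hk ?_
        exact (Submodule.mem_orthogonal_singleton_iff_inner_right).1
          (Submodule.starProjection_apply_mem _ x)
    _ = _ := by
        rw [lintegral_mul_const _ (by fun_prop), lintegral_starProjection_sq]
        congr 2
        have hne : b i ≠ 0 := b.orthonormal.ne_zero i
        have h2 := Submodule.finrank_add_finrank_orthogonal (ℂ ∙ b i)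
        rw [finrank_span_singleton hne, finrank_eq_card_basis b.toBasis] at h2
        omega

end Haar

/-! ### Second moments of sums of homogeneous functions over a random basis -/

section SecondMoment

variable {H : Type*} [NormedAddCommGroup H] [InnerProductSpace ℂ H] [FiniteDimensional ℂ H]
  [CompleteSpace H] [MeasurableSpace H] [BorelSpace H]

theorem norm_sub_inner_smul_sq {v : H} (hv : ‖v‖ = 1) (x : H) :
    ‖x - inner ℂ v x • v‖ ^ 2 = ‖x‖ ^ 2 - ‖inner ℂ v x‖ ^ 2 := by
  have h : inner ℂ (x - inner ℂ v x • v) (inner ℂ v x • v) = 0 := by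
    rw [inner_sub_left, inner_smul_right, inner_smul_left, inner_smul_right,
      inner_self_eq_norm_sq_to_K, hv, ← inner_conj_symm x v]
    simp [mul_comm]
  have h2 := norm_add_sq_eq_norm_sq_add_norm_sq_of_inner_eq_zero _ _ h
  rw [sub_add_cancel, norm_smul, hv, mul_one] at h2
  linarith

variable {F : H → ℝ≥0∞} {S : Submodule ℂ H}

/-- Since `F` factors through `P`, only the laws of `P x` and `P (R x)` matter. With `v` the
direction of `P u` and `a = ‖P u‖`, they share the component orthogonal to `v`, while along `v` the
second is scaled by `√(1 - a²)`; the density comparison for one complex Gaussian then gives the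
factor. -/
theorem lintegral_orthogonal_le_mul (hF : Measurable F)
    (hS : ∀ x, F (S.starProjection x) = F x) {u : H} (hu : ‖u‖ = 1)
    (ha : ‖S.starProjection u‖ < 1) :
    ∫⁻ x, F ((ℂ ∙ u)ᗮ.starProjection x) ∂stdComplexGaussian H ≤
      ENNReal.ofReal (1 - ‖S.starProjection u‖ ^ 2)⁻¹ * ∫⁻ x, F x ∂stdComplexGaussian H := by
  have := secondCountable_of_finiteDimensional H
  set P := S.starProjection with hP
  set R := (ℂ ∙ u)ᗮ.starProjection with hR
  set a := ‖P u‖ with ha'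
  have hRx (x : H) : R x = x - inner ℂ u x • u := starProjection_orthogonal_singleton u x hu
  -- If `P u = 0` there is no direction `v`, but then `P R = P` and nothing changes.
  rcases eq_or_ne a 0 with h0 | h0
  · have hPu : P u = 0 := norm_eq_zero.1 h0
    have h1 (x : H) : F (R x) = F x := by
      rw [← hS, hRx, map_sub, map_smul, hPu, smul_zero, sub_zero, hS]
    simp [h1, h0]
  have hapos : 0 < a := lt_of_le_of_ne (norm_nonneg _) h0.symm
  set v : H := ((a⁻¹ : ℝ) : ℂ) • P u with hv
  have hv1 : ‖v‖ = 1 := by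
    rw [hv, norm_smul, Complex.norm_real, ← ha', Real.norm_of_nonneg (by positivity),
      inv_mul_cancel₀ h0]
  have hPu : P u = (a : ℂ) • v := by
    rw [hv, smul_smul, ← Complex.ofReal_mul, mul_inv_cancel₀ h0]
    simp
  have hPv : P v = v := by
    rw [hv, map_smul,
      Submodule.starProjection_eq_self_iff.2 (Submodule.starProjection_apply_mem _ _)]
  have hsym (x y : H) : inner ℂ (P x) y = inner ℂ x (P y) :=
    Submodule.inner_starProjection_left_eq_right S x y
  have hvP (t : H) : inner ℂ v (P t) = inner ℂ v t := by rw [← hsym, hPv]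
  have hb2 : 0 < 1 - a ^ 2 := by nlinarith
  set β := √(1 - a ^ 2) with hβ
  have hβ0 : 0 < β := Real.sqrt_pos.2 hb2
  have hβ2 : β ^ 2 = 1 - a ^ 2 := Real.sq_sqrt hb2.le
  have hβ1 : β ≤ 1 := Real.sqrt_le_one.2 (by nlinarith)
  -- `D` projects onto the part of `S` orthogonal to `v`, the component common to both laws.
  set D : H →L[ℂ] H := P - InnerProductSpace.rankOne ℂ v v with hD
  have hDx (x : H) : D x = P x - inner ℂ v x • v := by simp [hD]
  have hDsym (x y : H) : inner ℂ (D x) y = inner ℂ x (D y) := by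
    rw [hDx, hDx, inner_sub_left, inner_sub_right, hsym, inner_smul_left, inner_smul_right,
      inner_conj_symm]
    ring
  have hDn (t : H) : ‖D t‖ ^ 2 = ‖P t‖ ^ 2 - ‖inner ℂ v t‖ ^ 2 := by
    rw [hDx, ← hvP, norm_sub_inner_smul_sq hv1]
  let e := stdOrthonormalBasis ℂ H
  have hform1 (t : H) : ∑ i, ‖inner ℂ (P (e i)) t‖ ^ 2 =
      ‖inner ℂ v t‖ ^ 2 + ∑ i, ‖inner ℂ (D (e i)) t‖ ^ 2 := by
    simp_rw [hsym, hDsym, e.sum_sq_norm_inner_right, hDn]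
    ring
  have hform2 (t : H) : ∑ i, ‖inner ℂ ((P ∘L R) (e i)) t‖ ^ 2 =
      ‖inner ℂ ((β : ℂ) • v) t‖ ^ 2 + ∑ i, ‖inner ℂ (D (e i)) t‖ ^ 2 := by
    simp_rw [ContinuousLinearMap.comp_apply, hsym, hDsym, hR,
      Submodule.inner_starProjection_left_eq_right, ← hR, e.sum_sq_norm_inner_right, hDn]
    have hscale (c : ℝ) : ‖inner ℂ ((c : ℂ) • v) t‖ ^ 2 = c ^ 2 * ‖inner ℂ v t‖ ^ 2 := by
      rw [inner_smul_left, norm_mul, mul_pow, Complex.conj_ofReal, Complex.norm_real,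
        Real.norm_eq_abs, sq_abs]
    rw [hRx, norm_sub_inner_smul_sq hu, ← hsym u t, hPu, hscale, hscale, hβ2]
    ring
  have hl1 : (stdComplexGaussian H).map P =
      (gaussLaw fun _ : Unit => v) ∗ gaussLaw fun i => D (e i) := by
    rw [← gaussLaw_eq_conv_of_form hform1, stdComplexGaussian, gaussLaw_map]
  have hl2 : (stdComplexGaussian H).map (P ∘L R) =
      (gaussLaw fun _ : Unit => (β : ℂ) • v) ∗ gaussLaw fun i => D (e i) := by
    rw [← gaussLaw_eq_conv_of_form hform2, stdComplexGaussian, gaussLaw_map]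
  calc ∫⁻ x, F (R x) ∂stdComplexGaussian H
      = ∫⁻ x, F x ∂(stdComplexGaussian H).map (P ∘L R) := by
        rw [lintegral_map hF (ContinuousLinearMap.continuous _).measurable]
        exact lintegral_congr fun x => (hS _).symm
    _ ≤ ENNReal.ofReal (1 - a ^ 2)⁻¹ * ∫⁻ x, F x ∂(stdComplexGaussian H).map P := by
        rw [hl1, hl2, Measure.lintegral_conv hF, Measure.lintegral_conv hF, ← hβ2,
          ← smul_eq_mul, ← lintegral_smul_measure]
        exact lintegral_mono' (gaussLaw_smul_le v hβ0 hβ1) le_rfl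
    _ = _ := by
        rw [lintegral_map hF (ContinuousLinearMap.continuous _).measurable]
        congr 1
        exact lintegral_congr hS

theorem lintegral_le_finrank (hb : ∀ x, F x ≤ ‖S.starProjection x‖ₑ ^ 2) :
    ∫⁻ x, F x ∂stdComplexGaussian H ≤ finrank ℂ S :=
  (lintegral_mono hb).trans (lintegral_starProjection_sq S).le

theorem enorm_add_sq_le (x y : H) : ‖x + y‖ₑ ^ 2 ≤ 2 * ‖x‖ₑ ^ 2 + 2 * ‖y‖ₑ ^ 2 := by
  have h : ‖x + y‖₊ ^ 2 ≤ 2 * ‖x‖₊ ^ 2 + 2 * ‖y‖₊ ^ 2 := by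
    rw [← NNReal.coe_le_coe]
    push_cast
    nlinarith [norm_add_le x y, norm_nonneg (x + y), sq_nonneg (‖x‖ - ‖y‖)]
  simp_rw [enorm_eq_nnnorm]
  exact_mod_cast h

/-- A crude bound for `u` close to `S`, where the density factor blows up: write `R x` as `x` minus
its component along `u`, which has mean squared norm one. -/
theorem lintegral_orthogonal_le_const (hb : ∀ x, F x ≤ ‖S.starProjection x‖ₑ ^ 2) {u : H}
    (hu : ‖u‖ = 1) :
    ∫⁻ x, F ((ℂ ∙ u)ᗮ.starProjection x) ∂stdComplexGaussian H ≤ 2 * (finrank ℂ S + 1) := by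
  have h (x : H) : F ((ℂ ∙ u)ᗮ.starProjection x) ≤
      2 * ‖S.starProjection x‖ₑ ^ 2 + 2 * ‖(ℂ ∙ u).starProjection x‖ₑ ^ 2 := by
    refine (hb _).trans ?_
    rw [Submodule.starProjection_orthogonal_val, map_sub, sub_eq_add_neg]
    refine (enorm_add_sq_le _ _).trans ?_
    rw [enorm_neg]
    gcongr
    rw [← ofReal_norm, ← ofReal_norm]
    exact ENNReal.ofReal_le_ofReal (Submodule.norm_starProjection_apply_le _ _)
  refine (lintegral_mono h).trans ?_
  have hne : u ≠ 0 := fun h0 => by simp [h0] at hu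
  rw [lintegral_add_left (by fun_prop), lintegral_const_mul _ (by fun_prop),
    lintegral_const_mul _ (by fun_prop), lintegral_starProjection_sq, lintegral_starProjection_sq,
    finrank_span_singleton hne, Nat.cast_one, mul_add]

/-- For `a² ≤ 1/2` the density factor is at most `1 + 2a²`; for `a² ≥ 1/2` the crude bound `2
(finrank ℂ S + 1)` is at most the error term, which is where the `4` comes from. An error of order
`a²` gives, after multiplication by `F u`, a fourth moment of `‖P u‖`. -/
theorem lintegral_orthogonal_le (hF : Measurable F)
    (hS : ∀ x, F (S.starProjection x) = F x) (hb : ∀ x, F x ≤ ‖S.starProjection x‖ₑ ^ 2) {u : H}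
    (hu : ‖u‖ = 1) :
    ∫⁻ x, F ((ℂ ∙ u)ᗮ.starProjection x) ∂stdComplexGaussian H ≤
      ∫⁻ x, F x ∂stdComplexGaussian H +
        4 * (finrank ℂ S + 1) * ‖S.starProjection u‖ₑ ^ 2 := by
  have ha : ‖S.starProjection u‖ₑ ^ 2 = ENNReal.ofReal (‖S.starProjection u‖ ^ 2) := by
    rw [← ofReal_norm, ENNReal.ofReal_pow (norm_nonneg _)]
  set a := ‖S.starProjection u‖
  set m := ∫⁻ x, F x ∂stdComplexGaussian H
  rcases le_total (a ^ 2) (1 / 2) with h | h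
  · have ha1 : a < 1 := by nlinarith [norm_nonneg (S.starProjection u)]
    refine (lintegral_orthogonal_le_mul hF hS hu ha1).trans ?_
    have h1 : (1 - a ^ 2)⁻¹ ≤ 1 + 2 * a ^ 2 := by
      rw [inv_le_iff_one_le_mul₀ (by nlinarith)]
      nlinarith [sq_nonneg a]
    have hm : m ≤ finrank ℂ S := lintegral_le_finrank hb
    calc ENNReal.ofReal (1 - a ^ 2)⁻¹ * m ≤ ENNReal.ofReal (1 + 2 * a ^ 2) * m := by gcongr
      _ = m + 2 * m * ENNReal.ofReal (a ^ 2) := by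
        rw [ENNReal.ofReal_add (by norm_num) (by positivity), ENNReal.ofReal_mul (by norm_num)]
        simp
        ring
      _ ≤ m + 4 * (finrank ℂ S + 1) * ‖S.starProjection u‖ₑ ^ 2 := by
        rw [ha]
        gcongr
        · norm_num
        · exact hm.trans le_self_add
  · refine (lintegral_orthogonal_le_const hb hu).trans (le_add_left ?_)
    calc (2 : ℝ≥0∞) * (finrank ℂ S + 1) = 4 * (finrank ℂ S + 1) * ENNReal.ofReal (1 / 2) := by
          rw [ENNReal.ofReal_div_of_pos (by norm_num), mul_right_comm]
          congr 1
          rw [ENNReal.ofReal_one, ENNReal.ofReal_ofNat, mul_one_div,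
            ENNReal.eq_div_iff (by norm_num) (by norm_num)]
          norm_num
      _ ≤ _ := by rw [ha]; gcongr

variable {ι : Type*} [Fintype ι] (b : OrthonormalBasis ι ℂ H)

theorem card_mul_lintegral_haarUnitary (hF : Measurable F) (hk : IsRealHomogeneous 2 F) (i : ι) :
    Fintype.card ι * ∫⁻ U, F (Unitary.linearIsometryEquiv U (b i)) ∂haarUnitary H =
      ∫⁻ x, F x ∂stdComplexGaussian H := by
  rw [lintegral_stdComplexGaussian_homogeneous b i hF hk, lintegral_norm_sq_stdComplexGaussian,
    finrank_eq_card_basis b.toBasis]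

/-- All summands have the same mean, and their number cancels `𝔼‖x‖²`: the random sum has no bias.
-/
theorem lintegral_sum_haarUnitary (hF : Measurable F) (hk : IsRealHomogeneous 2 F)
    [Nonempty ι] :
    ∫⁻ U, ∑ i, F (Unitary.linearIsometryEquiv U (b i)) ∂haarUnitary H =
      ∫⁻ x, F x ∂stdComplexGaussian H := by
  obtain ⟨i₀⟩ := ‹Nonempty ι›
  have hm (z : H) : Measurable fun U : unitary (H →L[ℂ] H) =>
      F (Unitary.linearIsometryEquiv U z) := hF.comp (measurable_unitary_apply z)
  rw [lintegral_finsetSum _ fun i _ => hm _]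
  have h (i : ι) := lintegral_haarUnitary_homogeneous b i₀ hF hk (b i)
  simp only [← ofReal_norm, b.norm_eq_one, ENNReal.ofReal_one, one_pow, one_mul] at h
  simp only [h, Finset.sum_const, Finset.card_univ, nsmul_eq_mul]
  exact card_mul_lintegral_haarUnitary b hF hk i₀

/-- The Gaussian fourth moment of the projection factors into a radial moment, at least the square
of the dimension, and the Haar average. -/
theorem sq_card_mul_lintegral_haarUnitary_pow_four (S : Submodule ℂ H) (i : ι) :
    (Fintype.card ι : ℝ≥0∞) ^ 2 *
        ∫⁻ U, ‖S.starProjection (Unitary.linearIsometryEquiv U (b i))‖ₑ ^ 4 ∂haarUnitary H ≤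
      finrank ℂ S ^ 2 * ∫⁻ z, ‖z‖ₑ ^ 4 ∂complexGaussian 1 := by
  have hk : IsRealHomogeneous 4 fun x : H => ‖S.starProjection x‖ₑ ^ 4 := by
    intro c x hc
    beta_reduce
    rw [map_smul, enorm_smul, mul_pow, ← ofReal_norm (c : ℂ), Complex.norm_real,
      Real.norm_of_nonneg hc]
  refine le_trans ?_ (lintegral_starProjection_pow_four S)
  rw [lintegral_stdComplexGaussian_homogeneous b i (by fun_prop) hk,
    ← finrank_eq_card_basis b.toBasis]
  gcongr
  exact sq_le_lintegral_norm_pow_four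

/-- The second moment of `∑ i, F (U b i)` for Haar distributed `U` exceeds the square of the
first moment by at most a multiple of `1 / dim H`. -/
theorem lintegral_sum_sq_haarUnitary_le (hF : Measurable F) (hk : IsRealHomogeneous 2 F)
    (hS : ∀ x, F (S.starProjection x) = F x) (hb : ∀ x, F x ≤ ‖S.starProjection x‖ₑ ^ 2)
    (hcard : 2 ≤ Fintype.card ι) :
    ∫⁻ U, (∑ i, F (Unitary.linearIsometryEquiv U (b i))) ^ 2 ∂haarUnitary H ≤
      (∫⁻ x, F x ∂stdComplexGaussian H) ^ 2 +
        (4 * (finrank ℂ S + 1) + 1) *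
          (finrank ℂ S ^ 2 * ∫⁻ z, ‖z‖ₑ ^ 4 ∂complexGaussian 1) / Fintype.card ι := by
  classical
  set m := ∫⁻ x, F x ∂stdComplexGaussian H with hmdef
  set C : ℝ≥0∞ := 4 * (finrank ℂ S + 1)
  set K : ℝ≥0∞ := finrank ℂ S ^ 2 * ∫⁻ z, ‖z‖ₑ ^ 4 ∂complexGaussian 1
  set n := Fintype.card ι
  have hn0 : (n : ℝ≥0∞) ≠ 0 := by simp; omega
  have hnt : (n : ℝ≥0∞) ≠ ∞ := ENNReal.natCast_ne_top n
  have hn1 : ((n - 1 : ℕ) : ℝ≥0∞) ≠ 0 := by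
    rw [Nat.cast_ne_zero]; omega
  have hn1t : ((n - 1 : ℕ) : ℝ≥0∞) ≠ ∞ := ENNReal.natCast_ne_top _
  have hm (z : H) : Measurable fun U : unitary (H →L[ℂ] H) =>
      F (Unitary.linearIsometryEquiv U z) := hF.comp (measurable_unitary_apply z)
  have hmP (z : H) : Measurable fun U : unitary (H →L[ℂ] H) =>
      ‖S.starProjection (Unitary.linearIsometryEquiv U z)‖ₑ ^ 4 :=
    ((ContinuousLinearMap.continuous _).measurable.comp
      (measurable_unitary_apply z)).enorm.pow_const 4
  have hK (i : ι) : ∫⁻ U, ‖S.starProjection (Unitary.linearIsometryEquiv U (b i))‖ₑ ^ 4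
      ∂haarUnitary H ≤ K / n ^ 2 := by
    rw [ENNReal.le_div_iff_mul_le (Or.inl (pow_ne_zero _ hn0)) (Or.inl (ENNReal.pow_ne_top hnt)),
      mul_comm]
    exact sq_card_mul_lintegral_haarUnitary_pow_four b S i
  have hdiag (i : ι) : ∫⁻ U, F (Unitary.linearIsometryEquiv U (b i)) *
      F (Unitary.linearIsometryEquiv U (b i)) ∂haarUnitary H ≤ K / n ^ 2 := by
    refine (lintegral_mono fun U => ?_).trans (hK i)
    calc _ ≤ ‖S.starProjection (Unitary.linearIsometryEquiv U (b i))‖ₑ ^ 2 *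
          ‖S.starProjection (Unitary.linearIsometryEquiv U (b i))‖ₑ ^ 2 :=
          mul_le_mul' (hb _) (hb _)
      _ = _ := by rw [← pow_add]
  -- The main term `m * (m / n)` is that of uncorrelated values; `C * (K / n ^ 2)` pays for the
  -- contraction along `P u`.
  have hoff (i j : ι) (hij : i ≠ j) : ∫⁻ U, F (Unitary.linearIsometryEquiv U (b i)) *
      F (Unitary.linearIsometryEquiv U (b j)) ∂haarUnitary H ≤
        (m * (m / n) + C * (K / n ^ 2)) / (n - 1 : ℕ) := by
    rw [ENNReal.le_div_iff_mul_le (Or.inl hn1) (Or.inl hn1t), mul_comm,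
      ← lintegral_haarUnitary_mul_gaussian_orthogonal b hij hF hk]
    have hpt (U : unitary (H →L[ℂ] H)) : F (Unitary.linearIsometryEquiv U (b i)) * ∫⁻ x,
        F ((ℂ ∙ Unitary.linearIsometryEquiv U (b i))ᗮ.starProjection x) ∂stdComplexGaussian H ≤
        m * F (Unitary.linearIsometryEquiv U (b i)) +
          C * ‖S.starProjection (Unitary.linearIsometryEquiv U (b i))‖ₑ ^ 4 := by
      have hu : ‖Unitary.linearIsometryEquiv U (b i)‖ = 1 := by
        rw [LinearIsometryEquiv.norm_map, b.norm_eq_one]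
      refine (mul_le_mul_right (lintegral_orthogonal_le hF hS hb hu) _).trans ?_
      rw [mul_add, mul_comm _ m]
      gcongr 1
      calc _ ≤ ‖S.starProjection (Unitary.linearIsometryEquiv U (b i))‖ₑ ^ 2 *
            (C * ‖S.starProjection (Unitary.linearIsometryEquiv U (b i))‖ₑ ^ 2) := by
            gcongr
            exact hb _
        _ = _ := by ring
    refine (lintegral_mono hpt).trans ?_
    rw [lintegral_add_left ((hm _).const_mul _), lintegral_const_mul _ (hm _),
      lintegral_const_mul _ (hmP _)]
    gcongr
    · rw [ENNReal.le_div_iff_mul_le (Or.inl hn0) (Or.inl hnt), mul_comm]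
      exact (card_mul_lintegral_haarUnitary b hF hk i).le
    · exact hK i
  have hmm (i j : ι) : Measurable fun U : unitary (H →L[ℂ] H) =>
      F (Unitary.linearIsometryEquiv U (b i)) * F (Unitary.linearIsometryEquiv U (b j)) :=
    (hm _).mul (hm _)
  have hexp (U : unitary (H →L[ℂ] H)) : (∑ i, F (Unitary.linearIsometryEquiv U (b i))) ^ 2 =
      ∑ i, ∑ j, F (Unitary.linearIsometryEquiv U (b i)) *
        F (Unitary.linearIsometryEquiv U (b j)) := by
    rw [sq, Finset.sum_mul_sum]
  rw [lintegral_congr hexp, lintegral_finsetSum _ fun i _ =>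
    Finset.measurable_fun_sum _ fun j _ => hmm i j]
  -- The `n - 1` off-diagonal terms cancel their denominator exactly; the diagonal turns `C` into `C
  -- + 1`.
  have hrow (i : ι) : ∫⁻ U, ∑ j, F (Unitary.linearIsometryEquiv U (b i)) *
      F (Unitary.linearIsometryEquiv U (b j)) ∂haarUnitary H ≤
        m * (m / n) + (C + 1) * (K / n ^ 2) := by
    rw [lintegral_finsetSum _ fun j _ => hmm i j,
      ← Finset.add_sum_erase _ _ (Finset.mem_univ i)]
    refine (add_le_add (hdiag i) (Finset.sum_le_sum fun j hj =>
      hoff i j (Finset.ne_of_mem_erase hj).symm)).trans ?_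
    rw [Finset.sum_const, Finset.card_erase_of_mem (Finset.mem_univ i), Finset.card_univ,
      nsmul_eq_mul, ENNReal.mul_div_cancel hn1 hn1t]
    apply le_of_eq
    ring
  refine (Finset.sum_le_sum fun i _ => hrow i).trans (le_of_eq ?_)
  rw [Finset.sum_const, Finset.card_univ, nsmul_eq_mul, mul_add]
  congr 1
  · rw [mul_left_comm, ENNReal.mul_div_cancel hn0 hnt, sq]
  · simp only [div_eq_mul_inv, sq, ENNReal.mul_inv (Or.inl hn0) (Or.inl hnt)]
    calc (n : ℝ≥0∞) * ((C + 1) * (K * ((n : ℝ≥0∞)⁻¹ * (n : ℝ≥0∞)⁻¹)))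
        = (C + 1) * K * (n : ℝ≥0∞)⁻¹ * (n * (n : ℝ≥0∞)⁻¹) := by ring
      _ = _ := by rw [ENNReal.mul_inv_cancel hn0 hnt, mul_one]

end SecondMoment

/-! ### The degree two extension of a function on the sphere -/

section RadialExt

variable {H : Type*} [NormedAddCommGroup H] [InnerProductSpace ℂ H]

open Classical in
/-- The extension `x ↦ ‖x‖² f (x / ‖x‖)` of a function on the unit sphere. -/
def radialExt (f : Metric.sphere (0 : H) 1 → ℝ) (x : H) : ℝ :=
  if h : x ≠ 0 then ‖x‖ ^ 2 * f (sphereProj ⟨x, h⟩) else 0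

theorem radialExt_of_ne_zero (f : Metric.sphere (0 : H) 1 → ℝ) {x : H} (h : x ≠ 0) :
    radialExt f x = ‖x‖ ^ 2 * f (sphereProj ⟨x, h⟩) := dif_pos h

@[simp] theorem radialExt_zero (f : Metric.sphere (0 : H) 1 → ℝ) : radialExt f 0 = 0 := by
  simp [radialExt]

theorem radialExt_smul (f : Metric.sphere (0 : H) 1 → ℝ) {c : ℝ} (hc : 0 ≤ c) (x : H) :
    radialExt f ((c : ℂ) • x) = c ^ 2 * radialExt f x := by
  rcases hc.eq_or_lt with rfl | hc
  · simp
  by_cases hx : x = 0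
  · simp [hx]
  have hcx : (c : ℂ) • x ≠ 0 := smul_ne_zero (by exact_mod_cast hc.ne') hx
  have hp : sphereProj ⟨(c : ℂ) • x, hcx⟩ = sphereProj ⟨x, hx⟩ := by
    apply Subtype.ext
    simp only [sphereProj, norm_smul, Complex.norm_real, Real.norm_of_nonneg hc.le, smul_smul,
      ← Complex.ofReal_mul]
    rw [mul_inv, mul_right_comm, inv_mul_cancel₀ hc.ne', one_mul]
  rw [radialExt_of_ne_zero f hcx, radialExt_of_ne_zero f hx, hp, norm_smul, Complex.norm_real,
    Real.norm_of_nonneg hc.le]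
  ring

theorem abs_radialExt_le {f : Metric.sphere (0 : H) 1 → ℝ} {M : ℝ} (hM : ∀ x, |f x| ≤ M) (x : H) :
    |radialExt f x| ≤ M * ‖x‖ ^ 2 := by
  by_cases hx : x = 0
  · simp [hx]
  rw [radialExt_of_ne_zero f hx, abs_mul, abs_of_nonneg (sq_nonneg _), mul_comm]
  gcongr
  exact hM _

theorem radialExt_nonneg {f : Metric.sphere (0 : H) 1 → ℝ} (hf : ∀ x, 0 ≤ f x) (x : H) :
    0 ≤ radialExt f x := by
  by_cases hx : x = 0
  · simp [hx]
  rw [radialExt_of_ne_zero f hx]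
  exact mul_nonneg (sq_nonneg _) (hf _)

/-- Reduces a function bounded by `M` to one with values in `[0, 1]`, so that the moment estimates
for `ℝ≥0∞`-valued functions apply. -/
theorem radialExt_eq_affine (f : Metric.sphere (0 : H) 1 → ℝ) {M : ℝ} (hM : M ≠ 0) (x : H) :
    radialExt f x = 2 * M * radialExt (fun y => (f y + M) / (2 * M)) x - M * ‖x‖ ^ 2 := by
  by_cases hx : x = 0
  · simp [hx]
  rw [radialExt_of_ne_zero f hx, radialExt_of_ne_zero _ hx]
  field_simp
  ring

variable [MeasurableSpace H] [BorelSpace H] [FiniteDimensional ℂ H]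

theorem measurable_sphereProj : Measurable (sphereProj : ({0}ᶜ : Set H) → _) := by
  have := secondCountable_of_finiteDimensional H
  refine Measurable.subtype_mk ?_
  have h : Measurable fun x : ({0}ᶜ : Set H) => ((‖(x : H)‖⁻¹ : ℝ) : ℂ) := by fun_prop
  exact h.smul measurable_subtype_coe

theorem measurable_radialExt {f : Metric.sphere (0 : H) 1 → ℝ} (hf : Measurable f) :
    Measurable (radialExt f) := by
  classical
  have h1 : Measurable fun x : {x : H | x ≠ 0} => ‖(x : H)‖ ^ 2 * f (sphereProj x) :=
    (by fun_prop : Measurable fun x : {x : H | x ≠ 0} => ‖(x : H)‖ ^ 2).mul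
      (hf.comp measurable_sphereProj)
  have h := Measurable.dite (s := {x : H | x ≠ 0}) h1
    (measurable_const (a := (0 : ℝ))) (measurableSet_singleton (0 : H)).compl
  refine (congrArg Measurable (funext fun x => ?_)).mp h
  unfold radialExt
  by_cases hx : x = 0
  · simp [hx]
  · simp only [Set.mem_ofPred_eq, ne_eq, hx, not_false_eq_true, dite_true]
    rfl

theorem abs_le_supNorm {f : Metric.sphere (0 : H) 1 → ℝ} (hf : ∃ C, ∀ x, |f x| ≤ C)
    (x : Metric.sphere (0 : H) 1) : |f x| ≤ supNorm f := by
  obtain ⟨C, hC⟩ := hf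
  exact le_ciSup (f := fun x => |f x|) ⟨C, by rintro _ ⟨y, rfl⟩; exact hC y⟩ x

theorem supNorm_pos {f : Metric.sphere (0 : H) 1 → ℝ} (hf : ∃ C, ∀ x, |f x| ≤ C) (h0 : f ≠ 0) :
    0 < supNorm f := by
  obtain ⟨x, hx⟩ := Function.ne_iff.1 h0
  exact (abs_pos.2 hx).trans_le (abs_le_supNorm hf x)

/-- The density `‖ψ‖²` is absorbed into the extension; omitting the origin loses nothing because the
density vanishes there. -/
theorem integral_gapMeasure {ρ : H →ₗ[ℂ] H} (hρ : ρ.IsSymmetric)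
    {f : Metric.sphere (0 : H) 1 → ℝ} (hf : Measurable f) :
    ∫ x, f x ∂gapMeasure ρ hρ = ∫ x, radialExt f x ∂gaussianMeasure ρ hρ := by
  classical
  set g : H → ℝ := fun x => if h : x ≠ 0 then f (sphereProj ⟨x, h⟩) else 0 with hg
  have hgm : Measurable g := Measurable.dite (s := {x : H | x ≠ 0})
    (hf.comp measurable_sphereProj) measurable_const (measurableSet_singleton (0 : H)).compl
  have h1 (x : ({0}ᶜ : Set H)) : f (sphereProj x) = g x := by
    have hx : (x : H) ≠ 0 := x.2
    simp [hg, hx]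
  rw [gapMeasure, integral_map measurable_sphereProj.aemeasurable
    hf.aestronglyMeasurable]
  simp_rw [h1]
  rw [integral_subtype_comap (measurableSet_singleton (0 : H)).compl g, gaMeasure,
    ← integral_indicator (measurableSet_singleton (0 : H)).compl,
    integral_withDensity_eq_integral_toReal_smul (by fun_prop)
      (Filter.Eventually.of_forall fun x => ENNReal.pow_lt_top enorm_lt_top)]
  refine integral_congr_ae (Filter.Eventually.of_forall fun x => ?_)
  by_cases hx : x = 0
  · simp [hx]
  · beta_reduce
    rw [Set.indicator_of_mem (show x ∈ ({0}ᶜ : Set H) from hx)]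
    simp [hg, hx, radialExt_of_ne_zero]

theorem integral_condMeasure {H₂ : Type*} [NormedAddCommGroup H₂] [InnerProductSpace ℂ H₂]
    {ι : Type*} [Fintype ι] (ψ : H ⊗[ℂ] H₂) (b : OrthonormalBasis ι ℂ H₂)
    {f : Metric.sphere (0 : H) 1 → ℝ} (hf : Measurable f) (hb : ∃ C, ∀ x, |f x| ≤ C) :
    ∫ x, f x ∂condMeasure ψ b = ∑ j, radialExt f (partialInner (b j) ψ) := by
  obtain ⟨C, hC⟩ := hb
  rw [condMeasure, integral_finsetSum_measure]
  · refine Finset.sum_congr rfl fun j _ => ?_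
    split_ifs with h
    · rw [integral_smul_measure, integral_dirac' _ _ hf.stronglyMeasurable,
        radialExt_of_ne_zero f h]
      simp
    · rw [not_not] at h
      simp [h]
  · intro j _
    split_ifs with h
    · refine Integrable.smul_measure ?_ (ENNReal.pow_ne_top enorm_ne_top)
      exact Integrable.of_bound hf.aestronglyMeasurable C (Filter.Eventually.of_forall hC)
    · exact integrable_zero_measure

end RadialExt

/-! ### Concentration from second moments -/

theorem measure_abs_sub_ge_le {Ω : Type*} [MeasurableSpace Ω] (μ : Measure Ω)
    [IsProbabilityMeasure μ] {Y : Ω → ℝ≥0∞} (hY : Measurable Y) (hY1 : ∀ ω, Y ω ≤ 1)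
    {m κ : ℝ≥0∞} (hm : ∫⁻ ω, Y ω ∂μ = m) (hκ : κ ≠ ∞) (h2 : ∫⁻ ω, Y ω ^ 2 ∂μ ≤ m ^ 2 + κ)
    {ε : ℝ} (hε : 0 < ε) :
    μ {ω | ε ≤ |(Y ω).toReal - m.toReal|} ≤ ENNReal.ofReal (κ.toReal / ε ^ 2) := by
  have hm1 : m ≤ 1 := by
    rw [← hm]
    exact (lintegral_mono hY1).trans (by simp)
  have hmt : m ≠ ∞ := ne_top_of_le_ne_top ENNReal.one_ne_top hm1
  have hE : ∫ ω, (Y ω).toReal ∂μ = m.toReal := by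
    rw [integral_toReal hY.aemeasurable (Filter.Eventually.of_forall fun ω =>
      (hY1 ω).trans_lt ENNReal.one_lt_top), hm]
  have hE2 : ∫ ω, (Y ω).toReal ^ 2 ∂μ = (∫⁻ ω, Y ω ^ 2 ∂μ).toReal := by
    rw [← integral_toReal (by fun_prop) (Filter.Eventually.of_forall fun ω =>
      ENNReal.pow_lt_top ((hY1 ω).trans_lt ENNReal.one_lt_top))]
    simp
  have hL : MemLp (fun ω => (Y ω).toReal) 2 μ := by
    refine MemLp.of_bound hY.ennreal_toReal.aestronglyMeasurable 1
      (Filter.Eventually.of_forall fun ω => ?_)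
    rw [Real.norm_of_nonneg ENNReal.toReal_nonneg]
    exact ENNReal.toReal_mono ENNReal.one_ne_top (hY1 ω)
  have hvar : Var[fun ω => (Y ω).toReal; μ] ≤ κ.toReal := by
    rw [variance_eq_sub hL]
    simp only [Pi.pow_apply]
    rw [hE, hE2, sub_le_iff_le_add', ← ENNReal.toReal_pow, ← ENNReal.toReal_add
      (ENNReal.pow_ne_top hmt) hκ]
    exact ENNReal.toReal_mono (ENNReal.add_ne_top.2 ⟨ENNReal.pow_ne_top hmt, hκ⟩) h2
  have h := meas_ge_le_variance_div_sq hL hε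
  rw [hE] at h
  refine h.trans (ENNReal.ofReal_le_ofReal ?_)
  gcongr

/-! ### The antilinear map of a Schmidt decomposition -/

section Antilinear

variable {H₁ : Type*} [NormedAddCommGroup H₁] [InnerProductSpace ℂ H₁]
variable {H₂ : Type*} [NormedAddCommGroup H₂] [InnerProductSpace ℂ H₂]
variable {ι : Type*} [Fintype ι]

/-- The antilinear map `y ↦ ∑ i, √(p i) ⟨y, φ i⟩ χ i`. -/
def antilinearMap (p : ι → ℝ) (χ : ι → H₁) (φ : ι → H₂) (y : H₂) : H₁ :=
  ∑ i, (((√(p i) : ℝ) : ℂ) * inner ℂ y (φ i)) • χ i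

theorem partialInner_tmul (b : H₂) (x : H₁) (y : H₂) :
    partialInner b (x ⊗ₜ[ℂ] y) = inner ℂ b y • x := by
  simp [partialInner]

theorem partialInner_schmidt (p : ι → ℝ) (χ : ι → H₁) (φ : ι → H₂) (b : H₂) :
    partialInner b (∑ i, ((√(p i) : ℝ) : ℂ) • (χ i ⊗ₜ[ℂ] φ i)) = antilinearMap p χ φ b := by
  have h (x y : H₁ ⊗[ℂ] H₂) : partialInner b (x + y) = partialInner b x + partialInner b y := by
    simp [partialInner]
  have h0 : partialInner b (0 : H₁ ⊗[ℂ] H₂) = 0 := by simp [partialInner]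
  have hs (c : ℂ) (x : H₁ ⊗[ℂ] H₂) : partialInner b (c • x) = c • partialInner b x := by
    simp [partialInner]
  let L : H₁ ⊗[ℂ] H₂ →+ H₁ := ⟨⟨partialInner b, h0⟩, h⟩
  change L _ = _
  rw [map_sum, antilinearMap]
  refine Finset.sum_congr rfl fun i _ => ?_
  change partialInner b _ = _
  rw [hs, partialInner_tmul, smul_smul]

variable {p : ι → ℝ} {χ : ι → H₁} {φ : ι → H₂}

theorem antilinearMap_smul_real (c : ℝ) (y : H₂) :
    antilinearMap p χ φ ((c : ℂ) • y) = (c : ℂ) • antilinearMap p χ φ y := by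
  simp only [antilinearMap, Finset.smul_sum, smul_smul, inner_smul_left, Complex.conj_ofReal]
  refine Finset.sum_congr rfl fun i _ => ?_
  ring_nf

theorem norm_antilinearMap_sq (hp : ∀ i, 0 ≤ p i) (hχ : Orthonormal ℂ χ) (y : H₂) :
    ‖antilinearMap p χ φ y‖ ^ 2 = ∑ i, p i * ‖inner ℂ (φ i) y‖ ^ 2 := by
  rw [antilinearMap, norm_sum_smul_sq hχ]
  refine Finset.sum_congr rfl fun i _ => ?_
  rw [norm_mul, mul_pow, norm_inner_symm, Complex.norm_real, Real.norm_eq_abs, sq_abs,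
    Real.sq_sqrt (hp i)]

theorem continuous_antilinearMap : Continuous (antilinearMap p χ φ) := by
  unfold antilinearMap
  fun_prop

variable [FiniteDimensional ℂ H₂]

/-- Only the inner products with the `φ i` enter. This confines all error terms to a subspace whose
dimension does not grow with `H₂`. -/
theorem antilinearMap_starProjection (y : H₂) :
    antilinearMap p χ φ ((Submodule.span ℂ (Set.range φ)).starProjection y) =
      antilinearMap p χ φ y := by
  unfold antilinearMap
  refine Finset.sum_congr rfl fun i _ => ?_
  rw [Submodule.inner_starProjection_left_eq_right, Submodule.starProjection_eq_self_iff.2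
    (Submodule.subset_span (Set.mem_range_self i))]

theorem norm_antilinearMap_sq_le (hp : ∀ i, 0 ≤ p i) (hp1 : ∀ i, p i ≤ 1) (hχ : Orthonormal ℂ χ)
    (hφ : Orthonormal ℂ φ) (y : H₂) :
    ‖antilinearMap p χ φ y‖ ^ 2 ≤
      ‖(Submodule.span ℂ (Set.range φ)).starProjection y‖ ^ 2 := by
  rw [← antilinearMap_starProjection, norm_antilinearMap_sq hp hχ]
  refine (Finset.sum_le_sum fun i _ => ?_).trans
    (hφ.sum_inner_products_le (s := Finset.univ) _)
  exact mul_le_of_le_one_left (sq_nonneg _) (hp1 i)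

theorem sum_norm_antilinearMap_sq {κ : Type*} [Fintype κ] (b : OrthonormalBasis κ ℂ H₂)
    (hp : ∀ i, 0 ≤ p i) (hp1 : ∑ i, p i = 1) (hχ : Orthonormal ℂ χ) (hφ : ∀ i, ‖φ i‖ = 1) :
    ∑ j, ‖antilinearMap p χ φ (b j)‖ ^ 2 = 1 := by
  simp_rw [norm_antilinearMap_sq hp hχ]
  rw [Finset.sum_comm, ← hp1]
  refine Finset.sum_congr rfl fun i _ => ?_
  rw [← Finset.mul_sum, b.sum_sq_norm_inner_left, hφ, one_pow, mul_one]

variable [FiniteDimensional ℂ H₁] [MeasurableSpace H₁] [BorelSpace H₁]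
  [MeasurableSpace H₂] [BorelSpace H₂]

section CharFun

attribute [local instance] InnerProductSpace.complexToReal

theorem charFun_stdComplexGaussian (t : H₂) :
    charFun (stdComplexGaussian H₂) t = Complex.exp (-((‖t‖ ^ 2 : ℝ) : ℂ) / 4) := by
  rw [stdComplexGaussian, charFun_gaussLaw, OrthonormalBasis.sum_sq_norm_inner_right]

/-- The map is not complex linear, so `gaussLaw_map` does not apply; the characteristic function
uses only the real inner product, for which the map has an adjoint. -/
theorem stdComplexGaussian_map_antilinearMap (hφ : Orthonormal ℂ φ) :
    (stdComplexGaussian H₂).map (antilinearMap p χ φ) =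
      gaussLaw fun i => ((√(p i) : ℝ) : ℂ) • χ i := by
  have := secondCountable_of_finiteDimensional H₁
  have := FiniteDimensional.complete ℂ H₁
  have := secondCountable_of_finiteDimensional H₂
  have hm : Measurable (antilinearMap p χ φ) := continuous_antilinearMap.measurable
  have : IsProbabilityMeasure ((stdComplexGaussian H₂).map (antilinearMap p χ φ)) :=
    Measure.isProbabilityMeasure_map hm.aemeasurable
  refine Measure.ext_of_charFun (funext fun t => ?_)
  -- The value at `t` of the real adjoint.
  set w : H₂ := ∑ i, (((√(p i) : ℝ) : ℂ) * inner ℂ t (χ i)) • φ i with hw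
  have hinner (y : H₂) : inner ℝ (antilinearMap p χ φ y) t = inner ℝ y w := by
    rw [real_inner_eq_re_inner ℂ, real_inner_eq_re_inner ℂ, ← inner_conj_symm, RCLike.conj_re, hw,
      antilinearMap, inner_sum, inner_sum]
    congr 1
    refine Finset.sum_congr rfl fun i _ => ?_
    rw [inner_smul_right, inner_smul_right]
    ring
  rw [charFun_apply, integral_map hm.aemeasurable (by fun_prop), charFun_gaussLaw]
  simp_rw [hinner]
  rw [← charFun_apply, charFun_stdComplexGaussian]
  congr 4
  rw [hw, norm_sum_smul_sq hφ]
  refine Finset.sum_congr rfl fun i _ => ?_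
  rw [norm_mul, norm_inner_symm, inner_smul_left, norm_mul, Complex.conj_ofReal]

end CharFun

theorem complexGaussian_map_sqrt_mul {q : ℝ} (hq : 0 ≤ q) :
    (complexGaussian 1).map (fun z => ((√q : ℝ) : ℂ) * z) = complexGaussian q := by
  have hm : Measurable fun z : ℝ × ℝ => (z.1 : ℂ) + (z.2 : ℂ) * Complex.I := by fun_prop
  have hg : (gaussianReal 0 (1 / 2 : ℝ).toNNReal).map (fun x => √q * x) =
      gaussianReal 0 (q / 2).toNNReal := by
    rw [gaussianReal_map_const_mul, mul_zero]
    congr 1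
    apply NNReal.eq
    rw [NNReal.coe_mul, NNReal.coe_mk, Real.sq_sqrt hq, Real.coe_toNNReal _ (by norm_num),
      Real.coe_toNNReal _ (by positivity)]
    ring
  rw [complexGaussian, complexGaussian, ← hg, Measure.map_prod_map _ _ (by fun_prop) (by fun_prop),
    Measure.map_map (by fun_prop) hm, Measure.map_map hm (by fun_prop)]
  congr 1
  ext z
  simp [mul_add, mul_assoc]

theorem gaussianMeasure_eq_gaussLaw {ρ : H₁ →ₗ[ℂ] H₁} (hρ : ρ.IsSymmetric)
    (hp : ∀ i, 0 ≤ hρ.eigenvalues rfl i) :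
    gaussianMeasure ρ hρ = gaussLaw fun i =>
      ((√(hρ.eigenvalues rfl i) : ℝ) : ℂ) • hρ.eigenvectorBasis rfl i := by
  have h (i) := complexGaussian_map_sqrt_mul (hp i)
  rw [gaussianMeasure]
  simp_rw [← h]
  rw [← Measure.pi_map_pi fun i => by fun_prop, Measure.map_map (measurable_sum_smul _)
    (by fun_prop), gaussLaw]
  congr 1
  ext z
  simp only [Function.comp_apply, smul_smul, mul_comm]

end Antilinear

/-! ### Concentration of the conditional wave function -/

section Concentration

/-- The constant in the variance bound for systems of dimension `d`. -/
def varianceConst (d : ℕ) : ℝ≥0∞ :=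
  (4 * (d + 1) + 1) * (d ^ 2 * ∫⁻ z, ‖z‖ₑ ^ 4 ∂complexGaussian 1)

theorem varianceConst_ne_top (d : ℕ) : varianceConst d ≠ ∞ := by
  have h (k : ℕ) : (k : ℝ≥0∞) ≠ ∞ := ENNReal.natCast_ne_top k
  have h5 : (4 * ((d : ℝ≥0∞) + 1) + 1) = ((4 * (d + 1) + 1 : ℕ) : ℝ≥0∞) := by push_cast; rfl
  rw [varianceConst, h5]
  exact ENNReal.mul_ne_top (h _) (ENNReal.mul_ne_top (ENNReal.pow_ne_top (h d))
    lintegral_norm_pow_four_complexGaussian_one)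

variable {H₁ : Type*} [NormedAddCommGroup H₁] [InnerProductSpace ℂ H₁] [FiniteDimensional ℂ H₁]
  [MeasurableSpace H₁] [BorelSpace H₁]
variable {H₂ : Type*} [NormedAddCommGroup H₂] [InnerProductSpace ℂ H₂] [FiniteDimensional ℂ H₂]
  [CompleteSpace H₂] [MeasurableSpace H₂] [BorelSpace H₂]
variable {ι κ : Type*} [Fintype ι] [Fintype κ] {p : ι → ℝ} {χ : ι → H₁} {φ : ι → H₂}

theorem enorm_sq_eq_ofReal (x : H₁) : ‖x‖ₑ ^ 2 = ENNReal.ofReal (‖x‖ ^ 2) := by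
  rw [← ofReal_norm, ENNReal.ofReal_pow (norm_nonneg _)]

theorem measurable_antilinearMap : Measurable (antilinearMap p χ φ) := by
  have := secondCountable_of_finiteDimensional H₁
  exact continuous_antilinearMap.measurable

/-- The mean identity for random bases reduces this to a sum that equals one for every basis. -/
theorem lintegral_antilinearMap_sq [Nonempty κ] (b : OrthonormalBasis κ ℂ H₂)
    (hp : ∀ i, 0 ≤ p i) (hp1 : ∑ i, p i = 1) (hχ : Orthonormal ℂ χ) (hφ : Orthonormal ℂ φ) :
    ∫⁻ y, ‖antilinearMap p χ φ y‖ₑ ^ 2 ∂stdComplexGaussian H₂ = 1 := by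
  have hk : IsRealHomogeneous 2 fun y => ‖antilinearMap p χ φ y‖ₑ ^ 2 := by
    intro c x hc
    beta_reduce
    rw [antilinearMap_smul_real, enorm_smul, mul_pow, ← ofReal_norm (c : ℂ), Complex.norm_real,
      Real.norm_of_nonneg hc]
  rw [← lintegral_sum_haarUnitary b (measurable_antilinearMap.enorm.pow_const 2) hk]
  have h (U : unitary (H₂ →L[ℂ] H₂)) :
      ∑ j, ‖antilinearMap p χ φ (Unitary.linearIsometryEquiv U (b j))‖ₑ ^ 2 = 1 := by
    have := sum_norm_antilinearMap_sq (b.map (Unitary.linearIsometryEquiv U)) hp hp1 hχ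
      hφ.norm_eq_one
    simp_rw [enorm_sq_eq_ofReal]
    rw [← ENNReal.ofReal_sum_of_nonneg fun _ _ => sq_nonneg _]
    simpa using congrArg ENNReal.ofReal this
  simp [h]

theorem integrable_norm_antilinearMap_sq [Nonempty κ] (b : OrthonormalBasis κ ℂ H₂)
    (hp : ∀ i, 0 ≤ p i) (hp1 : ∑ i, p i = 1) (hχ : Orthonormal ℂ χ) (hφ : Orthonormal ℂ φ) :
    Integrable (fun y => ‖antilinearMap p χ φ y‖ ^ 2) (stdComplexGaussian H₂) := by
  refine ⟨(measurable_antilinearMap.norm.pow_const 2).aestronglyMeasurable, ?_⟩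
  rw [hasFiniteIntegral_iff_enorm]
  simp only [enorm_pow, enorm_norm]
  rw [lintegral_antilinearMap_sq b hp hp1 hχ hφ]
  exact ENNReal.one_lt_top

/-- Chebyshev's inequality with the variance bound, applied to `F` built from the rescaled function
`g`. -/
theorem haarUnitary_deviation_le (b : OrthonormalBasis κ ℂ H₂) (hκ : 2 ≤ Fintype.card κ)
    (hp : ∀ i, 0 ≤ p i) (hp1 : ∑ i, p i = 1) (hχ : Orthonormal ℂ χ) (hφ : Orthonormal ℂ φ)
    {f : Metric.sphere (0 : H₁) 1 → ℝ} (hf : Measurable f) {M : ℝ} (hM : 0 < M)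
    (hfM : ∀ x, |f x| ≤ M) {ε : ℝ} (hε : 0 < ε) :
    haarUnitary H₂ {U | ε * M ≤
        |∑ j, radialExt f (antilinearMap p χ φ (Unitary.linearIsometryEquiv U (b j))) -
          ∫ y, radialExt f (antilinearMap p χ φ y) ∂stdComplexGaussian H₂|} ≤
      ENNReal.ofReal ((varianceConst (Fintype.card ι)).toReal / Fintype.card κ / (ε / 2) ^ 2) := by
  have hne : Nonempty κ := Fintype.card_pos_iff.1 (by omega)
  set T := antilinearMap p χ φ with hT
  have hTm : Measurable T := measurable_antilinearMap
  set g : Metric.sphere (0 : H₁) 1 → ℝ := fun y => (f y + M) / (2 * M) with hg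
  have hgm : Measurable g := by fun_prop
  have hg0 (x) : 0 ≤ g x := div_nonneg (by linarith [neg_abs_le (f x), hfM x]) (by positivity)
  have hg1 (x) : |g x| ≤ 1 := by
    rw [abs_of_nonneg (hg0 x), hg, div_le_one (by positivity)]
    linarith [le_abs_self (f x), hfM x]
  have hr0 (x : H₁) : 0 ≤ radialExt g x := radialExt_nonneg hg0 x
  have hr1 (x : H₁) : radialExt g x ≤ ‖x‖ ^ 2 := by
    simpa using (le_abs_self _).trans (abs_radialExt_le hg1 x)
  have hrm : Measurable (radialExt g) := measurable_radialExt hgm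
  set F : H₂ → ℝ≥0∞ := fun y => ENNReal.ofReal (radialExt g (T y)) with hF
  have hFm : Measurable F := (hrm.comp hTm).ennreal_ofReal
  have hFk : IsRealHomogeneous 2 F := by
    intro c x hc
    simp only [hF, hT]
    rw [antilinearMap_smul_real, radialExt_smul g hc, ENNReal.ofReal_mul (sq_nonneg c),
      ENNReal.ofReal_pow hc]
  set S := Submodule.span ℂ (Set.range φ) with hSdef
  have hS (y : H₂) : F (S.starProjection y) = F y := by
    simp only [hF, hT, hSdef, antilinearMap_starProjection]
  have hple (i : ι) : p i ≤ 1 := hp1 ▸ Finset.single_le_sum (fun j _ => hp j) (Finset.mem_univ i)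
  have hFb (y : H₂) : F y ≤ ‖S.starProjection y‖ₑ ^ 2 := by
    rw [enorm_sq_eq_ofReal]
    exact ENNReal.ofReal_le_ofReal ((hr1 _).trans (norm_antilinearMap_sq_le hp hple hχ hφ y))
  have hrank : finrank ℂ S = Fintype.card ι := finrank_span_eq_card hφ.linearIndependent
  have hm (z : H₂) : Measurable fun U : unitary (H₂ →L[ℂ] H₂) =>
      F (Unitary.linearIsometryEquiv U z) := hFm.comp (measurable_unitary_apply z)
  set Y : unitary (H₂ →L[ℂ] H₂) → ℝ≥0∞ :=
    fun U => ∑ j, F (Unitary.linearIsometryEquiv U (b j)) with hY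
  set m : ℝ≥0∞ := ∫⁻ y, F y ∂stdComplexGaussian H₂ with hmdef
  have hsumT (U : unitary (H₂ →L[ℂ] H₂)) :
      ∑ j, ‖T (Unitary.linearIsometryEquiv U (b j))‖ ^ 2 = 1 := by
    simpa using sum_norm_antilinearMap_sq (b.map (Unitary.linearIsometryEquiv U)) hp hp1 hχ
      hφ.norm_eq_one
  have hYr (U : unitary (H₂ →L[ℂ] H₂)) :
      Y U = ENNReal.ofReal (∑ j, radialExt g (T (Unitary.linearIsometryEquiv U (b j)))) :=
    (ENNReal.ofReal_sum_of_nonneg fun _ _ => hr0 _).symm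
  have hY1 (U : unitary (H₂ →L[ℂ] H₂)) : Y U ≤ 1 := by
    rw [hYr, ← ENNReal.ofReal_one, ← hsumT U]
    exact ENNReal.ofReal_le_ofReal (Finset.sum_le_sum fun j _ => hr1 _)
  have hYt (U : unitary (H₂ →L[ℂ] H₂)) : (Y U).toReal =
      ∑ j, radialExt g (T (Unitary.linearIsometryEquiv U (b j))) := by
    rw [hYr, ENNReal.toReal_ofReal (Finset.sum_nonneg fun _ _ => hr0 _)]
  have hint2 := integrable_norm_antilinearMap_sq b hp hp1 hχ hφ
  have hint1 : Integrable (fun y => radialExt g (T y)) (stdComplexGaussian H₂) := by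
    refine hint2.mono (hrm.comp hTm).aestronglyMeasurable (Filter.Eventually.of_forall fun y => ?_)
    rw [Real.norm_of_nonneg (hr0 _), Real.norm_of_nonneg (sq_nonneg _)]
    exact hr1 _
  have hmt : m.toReal = ∫ y, radialExt g (T y) ∂stdComplexGaussian H₂ := by
    rw [integral_eq_lintegral_of_nonneg_ae (Filter.Eventually.of_forall fun y => hr0 _)
      hint1.aestronglyMeasurable]
  have hT1 : ∫ y, ‖T y‖ ^ 2 ∂stdComplexGaussian H₂ = 1 := by
    rw [integral_eq_lintegral_of_nonneg_ae (Filter.Eventually.of_forall fun y => sq_nonneg _)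
      hint2.aestronglyMeasurable]
    simp_rw [← enorm_sq_eq_ofReal]
    rw [lintegral_antilinearMap_sq b hp hp1 hχ hφ, ENNReal.toReal_one]
  -- The shift by `M` cancels exactly, since `‖T ·‖²` sums to one over every basis and has Gaussian
  -- mean one. The factor `2 * M` is why the deviation of `Y` is compared with `ε / 2`.
  have hdiff (U : unitary (H₂ →L[ℂ] H₂)) :
      ∑ j, radialExt f (T (Unitary.linearIsometryEquiv U (b j))) -
          ∫ y, radialExt f (T y) ∂stdComplexGaussian H₂ = 2 * M * ((Y U).toReal - m.toReal) := by
    simp_rw [radialExt_eq_affine f hM.ne']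
    rw [Finset.sum_sub_distrib, ← Finset.mul_sum, ← Finset.mul_sum, hsumT,
      integral_sub (hint1.const_mul _) (hint2.const_mul _), integral_const_mul,
      integral_const_mul, hT1, hYt, hmt]
    ring
  have hset : {U | ε * M ≤
        |∑ j, radialExt f (T (Unitary.linearIsometryEquiv U (b j))) -
          ∫ y, radialExt f (T y) ∂stdComplexGaussian H₂|} =
      {U | ε / 2 ≤ |(Y U).toReal - m.toReal|} := by
    ext U
    simp only [Set.mem_ofPred_eq]
    rw [hdiff, abs_mul, abs_of_pos (by positivity : 0 < 2 * M)]
    constructor <;> intro h <;> nlinarith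
  have h2 := lintegral_sum_sq_haarUnitary_le b hFm hFk hS hFb hκ
  rw [hrank] at h2
  have hn0 : (Fintype.card κ : ℝ≥0∞) ≠ 0 := by simp
  rw [hset]
  refine (measure_abs_sub_ge_le (haarUnitary H₂) (Finset.measurable_fun_sum _ fun j _ => hm _) hY1
    (lintegral_sum_haarUnitary b hFm hFk)
    (ENNReal.div_ne_top (varianceConst_ne_top (Fintype.card ι)) hn0) h2 (half_pos hε)).trans
    (le_of_eq ?_)
  rw [ENNReal.toReal_div, ENNReal.toReal_natCast]

theorem one_sub_le_haarUnitary (b : OrthonormalBasis κ ℂ H₂) (hκ : 2 ≤ Fintype.card κ)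
    (hp : ∀ i, 0 ≤ p i) (hp1 : ∑ i, p i = 1) (hχ : Orthonormal ℂ χ) (hφ : Orthonormal ℂ φ)
    {f : Metric.sphere (0 : H₁) 1 → ℝ} (hf : Measurable f) {M : ℝ} (hM : 0 < M)
    (hfM : ∀ x, |f x| ≤ M) {ε δ : ℝ} (hε : 0 < ε) (hδ : 0 < δ)
    (hn : 4 * (varianceConst (Fintype.card ι)).toReal / (ε ^ 2 * δ) ≤ Fintype.card κ) :
    ENNReal.ofReal (1 - δ) ≤ haarUnitary H₂ {U |
        |∑ j, radialExt f (antilinearMap p χ φ (Unitary.linearIsometryEquiv U (b j))) -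
          ∫ y, radialExt f (antilinearMap p χ φ y) ∂stdComplexGaussian H₂| < ε * M} := by
  have hdev := haarUnitary_deviation_le b hκ hp hp1 hχ hφ hf hM hfM hε
  set A := {U : unitary (H₂ →L[ℂ] H₂) | ε * M ≤
        |∑ j, radialExt f (antilinearMap p χ φ (Unitary.linearIsometryEquiv U (b j))) -
          ∫ y, radialExt f (antilinearMap p χ φ y) ∂stdComplexGaussian H₂|} with hA
  have hAm : MeasurableSet A := by
    refine measurableSet_le measurable_const (Measurable.abs (Measurable.sub_const ?_ _))
    refine Finset.measurable_fun_sum _ fun j _ => ?_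
    exact (measurable_radialExt hf).comp (measurable_antilinearMap.comp (measurable_unitary_apply _))
  have hAc : Aᶜ = {U |
        |∑ j, radialExt f (antilinearMap p χ φ (Unitary.linearIsometryEquiv U (b j))) -
          ∫ y, radialExt f (antilinearMap p χ φ y) ∂stdComplexGaussian H₂| < ε * M} := by
    ext U
    simp [hA]
  rw [← hAc, prob_compl_eq_one_sub hAm, ENNReal.ofReal_sub _ hδ.le, ENNReal.ofReal_one]
  refine tsub_le_tsub_left (hdev.trans (ENNReal.ofReal_le_ofReal ?_)) 1
  have hn0 : (0 : ℝ) < Fintype.card κ := by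
    have : 0 < Fintype.card κ := by omega
    exact_mod_cast this
  rw [div_le_iff₀ (by positivity)] at hn
  rw [div_div, div_le_iff₀ (by positivity)]
  nlinarith

end Concentration

/-! ### Reduced density matrices and the Schmidt decomposition -/

section Schmidt

variable {H₁ : Type*} [NormedAddCommGroup H₁] [InnerProductSpace ℂ H₁] [FiniteDimensional ℂ H₁]
variable {H₂ : Type*} [NormedAddCommGroup H₂] [InnerProductSpace ℂ H₂] [FiniteDimensional ℂ H₂]
variable {ι : Type*} [Fintype ι]

/-- The partial inner product with a fixed vector, as a linear map. -/
def partialInnerₗ (b : H₂) : H₁ ⊗[ℂ] H₂ →ₗ[ℂ] H₁ :=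
  (TensorProduct.rid ℂ H₁).toLinearMap ∘ₗ LinearMap.lTensor H₁ (innerₛₗ ℂ b)

theorem partialInnerₗ_apply (b : H₂) (ψ : H₁ ⊗[ℂ] H₂) : partialInnerₗ b ψ = partialInner b ψ := rfl

theorem partialInner_sum_tmul (χ : ι → H₁) (y : ι → H₂) (b : H₂) :
    partialInner b (∑ i, χ i ⊗ₜ[ℂ] y i) = ∑ i, inner ℂ b (y i) • χ i := by
  rw [← partialInnerₗ_apply, map_sum]
  exact Finset.sum_congr rfl fun i _ => partialInner_tmul _ _ _

/-- In the basis `χ` the reduced density matrix is given by the Gram matrix of the `y i`, by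
Parseval in `H₂`. -/
theorem reducedDensity_sum_tmul (χ : OrthonormalBasis ι ℂ H₁) (y : ι → H₂) (k : ι) :
    reducedDensity (∑ i, χ i ⊗ₜ[ℂ] y i) (χ k) = ∑ i, inner ℂ (y k) (y i) • χ i := by
  classical
  simp only [reducedDensity, LinearMap.sum_apply, ContinuousLinearMap.coe_coe,
    InnerProductSpace.rankOne_apply, partialInner_sum_tmul]
  have h (j) : inner ℂ (∑ i, inner ℂ (stdOrthonormalBasis ℂ H₂ j) (y i) • χ i) (χ k) =
      inner ℂ (y k) (stdOrthonormalBasis ℂ H₂ j) := by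
    simp [χ.inner_eq_ite]
  simp_rw [h, Finset.smul_sum, smul_smul]
  rw [Finset.sum_comm]
  simp_rw [← Finset.sum_smul, OrthonormalBasis.sum_inner_mul_inner]

theorem norm_sum_tmul_sq (χ : OrthonormalBasis ι ℂ H₁) (y : ι → H₂) :
    ‖∑ i, χ i ⊗ₜ[ℂ] y i‖ ^ 2 = ∑ i, ‖y i‖ ^ 2 := by
  classical
  rw [← inner_self_eq_norm_sq (𝕜 := ℂ)]
  simp only [sum_inner, inner_sum, TensorProduct.inner_tmul, χ.inner_eq_ite, ite_mul, one_mul,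
    zero_mul, Finset.sum_ite_eq', Finset.mem_univ, if_true, map_sum,
    inner_self_eq_norm_sq]

theorem exists_eq_sum_tmul (χ : OrthonormalBasis ι ℂ H₁) (ψ : H₁ ⊗[ℂ] H₂) :
    ∃ y : ι → H₂, ψ = ∑ i, χ i ⊗ₜ[ℂ] y i := by
  obtain ⟨y, hy⟩ := TensorProduct.eq_repr_basis_left χ.toBasis ψ
  refine ⟨y, ?_⟩
  rw [← hy, Finsupp.sum_fintype _ _ (by simp)]
  simp

theorem isDensityOperator_reducedDensity {ψ : H₁ ⊗[ℂ] H₂} (hψ : ‖ψ‖ = 1) :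
    IsDensityOperator (reducedDensity ψ) := by
  refine ⟨LinearMap.isPositive_sum _ fun j _ =>
    (InnerProductSpace.isPositive_rankOne_self _).toLinearMap, ?_⟩
  classical
  let χ := stdOrthonormalBasis ℂ H₁
  obtain ⟨y, rfl⟩ := exists_eq_sum_tmul χ ψ
  have h1 := norm_sum_tmul_sq χ y
  rw [hψ, one_pow] at h1
  rw [LinearMap.trace_eq_sum_inner _ χ]
  simp_rw [reducedDensity_sum_tmul, inner_sum, inner_smul_right, χ.inner_eq_ite]
  simp only [mul_ite, mul_one, mul_zero, Finset.sum_ite_eq, Finset.mem_univ, if_true,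
    inner_self_eq_norm_sq_to_K]
  rw [← map_one (algebraMap ℝ ℂ), h1, map_sum]
  simp

theorem IsDensityOperator.sum_eigenvalues {ρ : H₁ →ₗ[ℂ] H₁} (hρ : IsDensityOperator ρ) :
    ∑ i, hρ.isPositive.isSymmetric.eigenvalues rfl i = 1 := by
  have h := hρ.isPositive.isSymmetric.trace_eq_sum_eigenvalues rfl
  rw [hρ.trace_eq_one] at h
  exact Complex.ofReal_injective (by simpa using h.symm)

theorem IsDensityOperator.finrank_pos {ρ : H₁ →ₗ[ℂ] H₁} (hρ : IsDensityOperator ρ) :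
    0 < finrank ℂ H₁ := by
  by_contra h
  have h0 : finrank ℂ H₁ = 0 := by omega
  have := hρ.sum_eigenvalues
  have : IsEmpty (Fin (finrank ℂ H₁)) := by rw [h0]; infer_instance
  simp_all

/-- The state `∑ i, √(p i) • χ i ⊗ φ i`. -/
def schmidtState {ρ : H₁ →ₗ[ℂ] H₁} (hρ : ρ.IsSymmetric) (φ : Fin (finrank ℂ H₁) → H₂) :
    H₁ ⊗[ℂ] H₂ :=
  ∑ i, ((√(hρ.eigenvalues rfl i) : ℝ) : ℂ) • (hρ.eigenvectorBasis rfl i ⊗ₜ[ℂ] φ i)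

theorem schmidtState_mem_stateSet {ρ : H₁ →ₗ[ℂ] H₁} (hρ : IsDensityOperator ρ)
    {φ : Fin (finrank ℂ H₁) → H₂} (hφ : Orthonormal ℂ φ) :
    schmidtState hρ.isPositive.isSymmetric φ ∈ stateSet ρ := by
  classical
  have hs := hρ.isPositive.isSymmetric
  have hp (i) : 0 ≤ hs.eigenvalues rfl i := hρ.isPositive.nonneg_eigenvalues rfl i
  have he : schmidtState hs φ = ∑ i, hs.eigenvectorBasis rfl i ⊗ₜ[ℂ]
      (((√(hs.eigenvalues rfl i) : ℝ) : ℂ) • φ i) := by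
    simp only [schmidtState, TensorProduct.tmul_smul]
  constructor
  · have h := norm_sum_tmul_sq (hs.eigenvectorBasis rfl)
      fun i => ((√(hs.eigenvalues rfl i) : ℝ) : ℂ) • φ i
    rw [← he] at h
    simp only [norm_smul, hφ.norm_eq_one, mul_one, Complex.norm_real, Real.norm_eq_abs, sq_abs,
      Real.sq_sqrt (hp _), hρ.sum_eigenvalues] at h
    exact (pow_eq_one_iff_of_nonneg (norm_nonneg _) two_ne_zero).1 h
  · rw [he]
    refine (hs.eigenvectorBasis rfl).toBasis.ext fun k => ?_
    rw [OrthonormalBasis.coe_toBasis, reducedDensity_sum_tmul, hs.apply_eigenvectorBasis]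
    simp only [inner_smul_left, inner_smul_right, orthonormal_iff_ite.1 hφ, mul_ite, mul_one,
      mul_zero, Complex.conj_ofReal, ite_smul, zero_smul, Finset.sum_ite_eq, Finset.mem_univ,
      if_true, ← Complex.ofReal_mul, Real.mul_self_sqrt (hp _)]
    rfl

/-- The Schmidt decomposition with a prescribed eigenbasis of the reduced density matrix. -/
theorem exists_schmidt_basis (hd : finrank ℂ H₁ ≤ finrank ℂ H₂) (ψ : H₁ ⊗[ℂ] H₂) :
    ∃ φ : OrthonormalBasis (Fin (finrank ℂ H₂)) ℂ H₂,
      ψ = schmidtState (reducedDensity_isSymmetric ψ) fun i => φ (Fin.castLE hd i) := by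
  classical
  set hs := reducedDensity_isSymmetric ψ
  set χ := hs.eigenvectorBasis rfl with hχ
  set p := hs.eigenvalues rfl with hp
  obtain ⟨y, hy⟩ := exists_eq_sum_tmul χ ψ
  -- In its own eigenbasis the Gram matrix is diagonal: the `y i` are orthogonal with squared norms
  -- `p i`.
  have hyy (k i) : inner ℂ (y k) (y i) = if i = k then (p k : ℂ) else 0 := by
    have h1 := hs.apply_eigenvectorBasis rfl k
    rw [← hχ, ← hp] at h1
    have h2 := congrArg (fun z => inner ℂ (χ i) z)
      ((congrArg (fun z => reducedDensity z (χ k)) hy).symm.trans h1)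
    simp only [reducedDensity_sum_tmul, inner_sum, inner_smul_right, χ.inner_eq_ite, mul_ite,
      mul_one, mul_zero, Finset.sum_ite_eq, Finset.mem_univ, if_true] at h2
    exact h2
  have hyn (i) : ‖y i‖ ^ 2 = p i := by
    have := hyy i i
    rw [if_pos rfl, inner_self_eq_norm_sq_to_K] at this
    exact Complex.ofReal_injective (by simpa using this)
  have hp0 (i) : 0 ≤ p i := hyn i ▸ sq_nonneg _
  let w : Fin (finrank ℂ H₂) → H₂ := fun k =>
    if h : (k : ℕ) < finrank ℂ H₁ then (((√(p ⟨k, h⟩))⁻¹ : ℝ) : ℂ) • y ⟨k, h⟩ else 0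
  -- When `p i = 0` the vector `y i` vanishes and cannot be normalised, so `φ` is prescribed on `s`
  -- only and is arbitrary elsewhere.
  let s : Set (Fin (finrank ℂ H₂)) := {k | ∃ i, Fin.castLE hd i = k ∧ p i ≠ 0}
  have hw (i) : w (Fin.castLE hd i) = (((√(p i))⁻¹ : ℝ) : ℂ) • y i := by
    simp only [w, Fin.val_castLE, i.2, dite_true]
  have hon : Orthonormal ℂ (s.domRestrict w) := by
    refine ⟨?_, ?_⟩
    · rintro ⟨_, i, rfl, hi⟩
      have hpos : 0 < √(p i) := Real.sqrt_pos.2 (lt_of_le_of_ne (hp0 i) hi.symm)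
      have hy' : ‖y i‖ = √(p i) := by rw [← hyn, Real.sqrt_sq (norm_nonneg _)]
      rw [Set.domRestrict_apply, hw, norm_smul, hy', Complex.norm_real,
        Real.norm_of_nonneg (by positivity), inv_mul_cancel₀ hpos.ne']
    · rintro ⟨_, i, rfl, hi⟩ ⟨_, j, rfl, hj⟩ hij
      have hne : j ≠ i := fun h => hij (by simp [h])
      simp only [Set.domRestrict_apply, hw]
      rw [inner_smul_left, inner_smul_right, hyy, if_neg hne, mul_zero, mul_zero]
  obtain ⟨φ, hφ⟩ := hon.exists_orthonormalBasis_extension_of_card_eq (by simp)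
  refine ⟨φ, ?_⟩
  nth_rw 1 [hy]
  refine Finset.sum_congr rfl fun i _ => ?_
  rw [← TensorProduct.tmul_smul]
  congr 1
  by_cases hi : p i = 0
  · have : y i = 0 := by
      have := hyn i
      rw [hi] at this
      simpa using this
    rw [this, ← hp, hi]
    simp
  · beta_reduce
    rw [hφ _ ⟨i, rfl, hi⟩, hw, smul_smul, ← Complex.ofReal_mul, mul_inv_cancel₀
      (Real.sqrt_ne_zero'.2 (lt_of_le_of_ne (hp0 i) (Ne.symm hi)))]
    simp

end Schmidt

/-! ### The two typicality properties -/

section Typicality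

variable {H₁ : Type*} [NormedAddCommGroup H₁] [InnerProductSpace ℂ H₁] [FiniteDimensional ℂ H₁]
  [MeasurableSpace H₁] [BorelSpace H₁]
variable {H₂ : Type*} [NormedAddCommGroup H₂] [InnerProductSpace ℂ H₂] [FiniteDimensional ℂ H₂]
  [CompleteSpace H₂] [MeasurableSpace H₂] [BorelSpace H₂]

instance borelSpace_tensor : BorelSpace (H₁ ⊗[ℂ] H₂) := ⟨rfl⟩

theorem measurable_map_stdOrthonormalBasis :
    Measurable fun U : unitary (H₂ →L[ℂ] H₂) =>
      (stdOrthonormalBasis ℂ H₂).map (Unitary.linearIsometryEquiv U) := by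
  refine measurable_comap_iff.2 (measurable_pi_iff.2 fun i => ?_)
  simpa [Function.comp_def] using measurable_unitary_apply (stdOrthonormalBasis ℂ H₂ i)

theorem le_uniformONB (s : Set (OrthonormalBasis (Fin (finrank ℂ H₂)) ℂ H₂)) :
    haarUnitary H₂ {U | (stdOrthonormalBasis ℂ H₂).map (Unitary.linearIsometryEquiv U) ∈ s} ≤
      uniformONB H₂ s :=
  Measure.le_map_apply measurable_map_stdOrthonormalBasis.aemeasurable s

theorem measurable_schmidtState {ρ : H₁ →ₗ[ℂ] H₁} (hρ : ρ.IsSymmetric)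
    (hd : finrank ℂ H₁ ≤ finrank ℂ H₂) :
    Measurable fun b : OrthonormalBasis (Fin (finrank ℂ H₂)) ℂ H₂ =>
      schmidtState hρ fun i => b (Fin.castLE hd i) := by
  have := secondCountable_of_finiteDimensional H₂
  have h1 : Measurable fun (b : OrthonormalBasis (Fin (finrank ℂ H₂)) ℂ H₂) i => b i :=
    comap_measurable _
  have h2 : Continuous fun b : Fin (finrank ℂ H₂) → H₂ =>
      schmidtState hρ fun i => b (Fin.castLE hd i) := by
    refine continuous_finsetSum _ fun i _ => ?_
    have h3 : Continuous fun b : Fin (finrank ℂ H₂) → H₂ =>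
        hρ.eigenvectorBasis rfl i ⊗ₜ[ℂ] b (Fin.castLE hd i) :=
      TensorProduct.continuous_tmul.comp
        (continuous_const.prodMk (continuous_apply (Fin.castLE hd i)))
    exact (continuous_const_smul _).comp h3
  exact h2.measurable.comp h1

theorem uniformState_eq_map {ρ : H₁ →ₗ[ℂ] H₁} (hρ : ρ.IsSymmetric)
    (hd : finrank ℂ H₁ ≤ finrank ℂ H₂) :
    uniformState ρ hρ hd = (haarUnitary H₂).map fun U => schmidtState hρ fun i =>
      Unitary.linearIsometryEquiv U (stdOrthonormalBasis ℂ H₂ (Fin.castLE hd i)) := by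
  change (uniformONB H₂).map (fun b => schmidtState hρ fun i => b (Fin.castLE hd i)) = _
  rw [uniformONB, Measure.map_map (measurable_schmidtState hρ hd)
    measurable_map_stdOrthonormalBasis]
  congr 1

theorem measurable_schmidtState_unitary {ρ : H₁ →ₗ[ℂ] H₁} (hρ : ρ.IsSymmetric)
    (hd : finrank ℂ H₁ ≤ finrank ℂ H₂) :
    Measurable fun U : unitary (H₂ →L[ℂ] H₂) => schmidtState hρ fun i =>
      Unitary.linearIsometryEquiv U (stdOrthonormalBasis ℂ H₂ (Fin.castLE hd i)) := by
  have h := (measurable_schmidtState hρ hd).comp measurable_map_stdOrthonormalBasis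
  simpa [Function.comp_def] using h

theorem partialInner_schmidtState {ρ : H₁ →ₗ[ℂ] H₁} (hρ : ρ.IsSymmetric)
    (φ : Fin (finrank ℂ H₁) → H₂) (b : H₂) :
    partialInner b (schmidtState hρ φ) =
      antilinearMap (hρ.eigenvalues rfl) (hρ.eigenvectorBasis rfl) φ b :=
  partialInner_schmidt _ _ _ _

theorem unitary_apply_inv_apply (U : unitary (H₂ →L[ℂ] H₂)) (x : H₂) :
    Unitary.linearIsometryEquiv U (Unitary.linearIsometryEquiv U⁻¹ x) = x := by
  have h := congrArg (fun W => Unitary.linearIsometryEquiv W x) (mul_inv_cancel U)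
  simp only [map_mul, map_one] at h
  exact h

theorem inner_unitary_right (U : unitary (H₂ →L[ℂ] H₂)) (x y : H₂) :
    inner ℂ x (Unitary.linearIsometryEquiv U y) = inner ℂ (Unitary.linearIsometryEquiv U⁻¹ x) y := by
  rw [← (Unitary.linearIsometryEquiv U).inner_map_map (Unitary.linearIsometryEquiv U⁻¹ x) y,
    unitary_apply_inv_apply]

/-- The duality between random states and random bases: a rotation of the Schmidt vectors moves to
the other side of the inner product as its inverse. -/
theorem partialInner_schmidtState_unitary {ρ : H₁ →ₗ[ℂ] H₁} (hρ : ρ.IsSymmetric)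
    (φ : Fin (finrank ℂ H₁) → H₂) (U : unitary (H₂ →L[ℂ] H₂)) (b : H₂) :
    partialInner b (schmidtState hρ fun i => Unitary.linearIsometryEquiv U (φ i)) =
      partialInner (Unitary.linearIsometryEquiv U⁻¹ b) (schmidtState hρ φ) := by
  rw [partialInner_schmidtState, partialInner_schmidtState]
  unfold antilinearMap
  simp_rw [inner_unitary_right]

theorem integral_gapMeasure_eq {ρ : H₁ →ₗ[ℂ] H₁} (hρ : IsDensityOperator ρ)
    {φ : Fin (finrank ℂ H₁) → H₂} (hφ : Orthonormal ℂ φ)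
    {f : Metric.sphere (0 : H₁) 1 → ℝ} (hf : Measurable f) :
    ∫ x, f x ∂gapMeasure ρ hρ.isPositive.isSymmetric =
      ∫ y, radialExt f (antilinearMap (hρ.isPositive.isSymmetric.eigenvalues rfl)
        (hρ.isPositive.isSymmetric.eigenvectorBasis rfl) φ y) ∂stdComplexGaussian H₂ := by
  rw [integral_gapMeasure _ hf, gaussianMeasure_eq_gaussLaw _
    (fun i => hρ.isPositive.nonneg_eigenvalues rfl i),
    ← stdComplexGaussian_map_antilinearMap (χ := hρ.isPositive.isSymmetric.eigenvectorBasis rfl) hφ,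
    integral_map measurable_antilinearMap.aemeasurable
      (measurable_radialExt hf).aestronglyMeasurable]

theorem orthonormal_comp_castLE {m n : ℕ} (h : m ≤ n) (b : OrthonormalBasis (Fin n) ℂ H₂) :
    Orthonormal ℂ fun i => b (Fin.castLE h i) :=
  b.orthonormal.comp _ (Fin.castLE_injective h)

/-- The bound is what Chebyshev requires, the `4` coming from `(ε / 2) ^ 2`. The summand `1` keeps
it positive also for `d₁ = 0`, where the variance constant vanishes. -/
theorem typicalStateProperty {ε δ : ℝ} (hε : 0 < ε) (hδ : 0 < δ) (d₁ : ℕ) :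
    TypicalStateProperty.{u, v} ε δ d₁ (4 * (varianceConst d₁).toReal / (ε ^ 2 * δ) + 1) := by
  intro H₁ _ _ _ _ _ H₂ _ _ _ _ _ _ hd₁ hd hD b ρ hρ f hf hfb hf0
  have hs := hρ.isPositive.isSymmetric
  set φ : Fin (finrank ℂ H₁) → H₂ := fun i => stdOrthonormalBasis ℂ H₂ (Fin.castLE hd.le i)
  have hφ : Orthonormal ℂ φ := orthonormal_comp_castLE hd.le _
  have hcard : 2 ≤ Fintype.card (Fin (finrank ℂ H₂)) := by
    have := hρ.finrank_pos
    rw [Fintype.card_fin]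
    omega
  have h := one_sub_le_haarUnitary b hcard (fun i => hρ.isPositive.nonneg_eigenvalues rfl i)
    hρ.sum_eigenvalues (hs.eigenvectorBasis rfl).orthonormal hφ hf (supNorm_pos hfb hf0)
    (abs_le_supNorm hfb) hε hδ (by rw [Fintype.card_fin, Fintype.card_fin, hd₁]; linarith)
  -- The estimate concerns a rotated basis; inversion invariance replaces `U` by `U⁻¹`, as needed
  -- for a rotated state.
  rw [← integral_gapMeasure_eq hρ hφ hf,
    ← measurePreserving_inv_haarUnitary.measure_preimage_equiv (f := MeasurableEquiv.inv _)] at h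
  rw [uniformState_eq_map]
  -- The inequality between a measure of a preimage and the pushforward holds for every set, so
  -- measurability of `stateSet` is not needed.
  refine (h.trans (measure_mono fun U hU => ?_)).trans
    (Measure.le_map_apply (measurable_schmidtState_unitary hs hd.le).aemeasurable _)
  refine ⟨schmidtState_mem_stateSet hρ (hφ.comp_linearIsometryEquiv _), ?_⟩
  rw [integral_condMeasure _ _ hf hfb]
  have hj (j) : partialInner (b j) (schmidtState hs fun i => Unitary.linearIsometryEquiv U
      (stdOrthonormalBasis ℂ H₂ (Fin.castLE hd.le i))) =
      antilinearMap (hs.eigenvalues rfl) (hs.eigenvectorBasis rfl) φ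
        (Unitary.linearIsometryEquiv U⁻¹ (b j)) := by
    rw [partialInner_schmidtState_unitary hs φ U, partialInner_schmidtState]
  simp_rw [hj]
  exact hU

theorem measurable_partialInner (b : H₂) :
    Measurable (partialInner b : H₁ ⊗[ℂ] H₂ → H₁) := by
  have := (partialInnerₗ (H₁ := H₁) b).continuous_of_finiteDimensional
  exact this.measurable

theorem typicalBasisProperty_of_typicalStateProperty {ε δ : ℝ} {d₁ : ℕ} {D : ℝ}
    (hA : TypicalStateProperty.{u, v} ε δ d₁ D) : TypicalBasisProperty.{u, v} ε δ d₁ D := by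
  intro H₁ _ _ _ _ _ H₂ _ _ _ _ _ _ hd₁ hd hD ψ hψ f hf hfb hf0
  have hρ := isDensityOperator_reducedDensity hψ
  have hs := hρ.isPositive.isSymmetric
  set e := stdOrthonormalBasis ℂ H₂ with he
  set c := ∫ x, f x ∂gapMeasure (reducedDensity ψ) hs with hc
  -- Dropping membership in `stateSet` gives a larger set that is visibly measurable, so the
  -- pushforward can be evaluated as the measure of a preimage.
  set Q : Set (H₁ ⊗[ℂ] H₂) :=
    {η | |∑ j, radialExt f (partialInner (e j) η) - c| < ε * supNorm f} with hQ
  have hQm : MeasurableSet Q := by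
    refine measurableSet_lt (Measurable.abs (Measurable.sub_const ?_ _)) measurable_const
    exact Finset.measurable_fun_sum _ fun j _ =>
      (measurable_radialExt hf).comp (measurable_partialInner _)
  have h := hA H₁ H₂ hd₁ hd hD e (reducedDensity ψ) hρ f hf hfb hf0
  replace h := h.trans (measure_mono (t := Q) fun η hη => by
    have := hη.2
    rwa [integral_condMeasure _ _ hf hfb] at this)
  rw [uniformState_eq_map, Measure.map_apply (measurable_schmidtState_unitary hs hd.le) hQm] at h
  obtain ⟨φ, hφ⟩ := exists_schmidt_basis hd.le ψ
  -- `V` carries the reference basis to the Schmidt basis of `ψ`. Under the measure-preserving map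
  -- `U ↦ U⁻¹ * V` the random state becomes `ψ` with Schmidt vectors rotated by `U⁻¹`, that is, `ψ`
  -- seen from the basis rotated by `U`.
  obtain ⟨V, hV⟩ : ∃ V : unitary (H₂ →L[ℂ] H₂), ∀ i, Unitary.linearIsometryEquiv V (e i) = φ i :=
    ⟨Unitary.linearIsometryEquiv.symm (e.equiv φ (Equiv.refl _)), fun i => by simp⟩
  have hpres := (measurePreserving_mul_right_haarUnitary V).comp
    (measurePreserving_inv_haarUnitary (H := H₂))
  rw [← hpres.measure_preimage
    (measurable_schmidtState_unitary hs hd.le hQm).nullMeasurableSet] at h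
  refine (h.trans (measure_mono fun U hU => ?_)).trans (le_uniformONB _)
  change |∫ x, f x ∂condMeasure ψ (e.map (Unitary.linearIsometryEquiv U)) - c| < ε * supNorm f
  rw [integral_condMeasure _ _ hf hfb]
  have hj (j) : partialInner (e j) (schmidtState hs fun i =>
      Unitary.linearIsometryEquiv (U⁻¹ * V) (e (Fin.castLE hd.le i))) =
      partialInner (e.map (Unitary.linearIsometryEquiv U) j) ψ := by
    conv_rhs => rw [hφ]
    have hUV (x : H₂) : Unitary.linearIsometryEquiv (U⁻¹ * V) x =
        Unitary.linearIsometryEquiv U⁻¹ (Unitary.linearIsometryEquiv V x) := by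
      rw [map_mul]; rfl
    simp_rw [hUV, hV]
    rw [partialInner_schmidtState_unitary hs (fun i => φ (Fin.castLE hd.le i)), inv_inv]
    rfl
  have hU' : |∑ j, radialExt f (partialInner (e j) (schmidtState hs fun i =>
      Unitary.linearIsometryEquiv (U⁻¹ * V) (e (Fin.castLE hd.le i)))) - c| < ε * supNorm f := hU
  simp_rw [hj] at hU'
  exact hU'

end Typicality
end

theorem theorem2 (ε δ : ℝ) (hε : 0 < ε) (hε1 : ε < 1) (hδ : 0 < δ) (hδ1 : δ < 1) (d₁ : ℕ) :
    (∃ D₂ : ℝ, 0 < D₂ ∧ TypicalStateProperty.{u, v} ε δ d₁ D₂ ∧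
      TypicalBasisProperty.{u, v} ε δ d₁ D₂) ∧
    (∀ D₂ : ℝ, 0 < D₂ → TypicalStateProperty.{u, v} ε δ d₁ D₂ →
      TypicalBasisProperty.{u, v} ε δ d₁ D₂) := by
  have hA := typicalStateProperty.{u, v} hε hδ d₁
  refine ⟨⟨_, ?_, hA, typicalBasisProperty_of_typicalStateProperty hA⟩,
    fun D₂ _ h => typicalBasisProperty_of_typicalStateProperty h⟩
  positivity
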